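/- Let $N\ge 1$ and let $0<\varepsilon<1$, $0<c_1<1<C_1$, $C_2>1$. Let $\mathbf H=\{h_{ij}\}$ be an $N\times N$ generalized Wigner matrix, that is, a random real symmetric matrix whose entries $h_{ij}$, $i\le j$, are mutually independent and centered and which, with $s_{ij}=\mathbb E[|h_{ij}|^2]$, satisfies for all $i,j$ $$c_1<Ns_{ij}<C_1,\qquad \Big|\sum_{k=1}^N s_{ik}-1\Big|<C_1N^{-\varepsilon},\qquad \mathbb E\big[|h_{ij}\sqrt N|^{2+\varepsilon}\big]<C_2 .$$ Let $B_{ij}=B_{ji}$ be standard Brownian motions, mutually independent for $i\le j$ and independent of $\mathbf H$. Let $\mathbf H_s=\{h_{ij}(s)\}_{s\ge 0}$ be the symmetric matrix process with continuous paths that starts at $\mathbf H_0=\mathbf H$ and solves $$dh_{ij}(s)=N^{-1/2}\,dB_{ij}(s)-(2Ns_{ij})^{-1}h_{ij}(s)\,ds .$$ Let $\mathbf X_{ij}$ be the $N\times N$ matrix with entries $1$ at the positions $(i,j)$ and $(j,i)$ and $0$ elsewhere. For a symmetric matrix $\mathbf M$ and $\theta\in[0,1]$, let $\Theta_{ij}\mathbf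 M=\Theta_{ij}^{(\theta)}\mathbf M$ be $\mathbf M$ with its entries at $(i,j)$ and $(j,i)$ multiplied by $\theta$. Put $\partial_{ij}F(\mathbf M)=\lim_{y\to 0}y^{-1}\big(F(\mathbf M+y\mathbf X_{ij})-F(\mathbf M)\big)$. Let $t\ge 0$, and let $F$ be a smooth function from the real symmetric $N\times N$ matrices to $\mathbb C$ such that the family $\{F(\mathbf H_s)\}_{0\le s\le t}$ is uniformly integrable (for example, $F$ bounded). Then $$\Big|\mathbb E\big[F(\mathbf H_t)-F(\mathbf H_0)\big]\Big|\le tN\,\sup_{0\le s\le t}\Xi(s),$$ where $$\begin{aligned}\Xi(s)=\max_{1\le i,j\le N}\Big(& s_{ij}^{-1}\,\mathbb E\Big[\mathbf 1_{|h_{ij}(s)|\ge N^{-\varepsilon/10}}\,|h_{ij}(s)|\sup_{0\le\theta\le1}\big|\partial_{ij}F(\Theta_{ij}\mathbf H_s)\big|\Big]\\ &+s_{ij}^{-1}\,\mathbb E\Big[\mathbf 1_{|h_{ij}(s)|\ge N^{-\varepsilon/10}}\,|h_{ij}(s)|^2\sup_{0\le\theta\le1}\big|\partial_{ij}^2F(\Theta_{ij}\mathbf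 H_s)\big|\Big]\\ &+\mathbb E\Big[\mathbf 1_{|h_{ij}(s)|\ge N^{-\varepsilon/10}}\sup_{0\le\theta\le1}\big|\partial_{ij}^2F(\Theta_{ij}\mathbf H_s)\big|\Big]\\ &+s_{ij}^{-1}\,\mathbb E\Big[\mathbf 1_{|h_{ij}(s)|<N^{-\varepsilon/10}}\,|h_{ij}(s)|^3\sup_{0\le\theta\le1}\big|\partial_{ij}^3F(\Theta_{ij}\mathbf H_s)\big|\Big]\\ &+\mathbb E\Big[\mathbf 1_{|h_{ij}(s)|<N^{-\varepsilon/10}}\,|h_{ij}(s)|\sup_{0\le\theta\le1}\big|\partial_{ij}^3F(\Theta_{ij}\mathbf H_s)\big|\Big]\Big),\end{aligned}$$ with $\Xi(s)\in[0,\infty]$ and the convention $0\cdot\infty=0$ at $t=0$. -/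

import Mathlib

open MeasureTheory ProbabilityTheory
open scoped NNReal ENNReal

-- Norm on matrices (largest absolute value of an entry). All norms are equivalent here; it only
-- serves to make sense of smoothness of functions of a symmetric matrix.
attribute [local instance] Matrix.normedAddCommGroup Matrix.normedSpace

noncomputable section

namespace WignerFlow

/-- The space of real symmetric `N × N` matrices, as a subspace of all matrices. -/
def symmSubmodule (N : ℕ) : Submodule ℝ (Matrix (Fin N) (Fin N) ℝ) where
  carrier := {A | A.IsSymm}
  add_mem' := fun hA hB => Matrix.IsSymm.add hA hB
  zero_mem' := Matrix.isSymm_zero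
  smul_mem' := fun c _ hA => Matrix.IsSymm.smul hA c

/-- Real symmetric `N × N` matrices. -/
abbrev SymMat (N : ℕ) : Type := symmSubmodule N

/-- The `(i, j)` entry of a symmetric matrix. -/
def entry {N : ℕ} (M : SymMat N) (i j : Fin N) : ℝ := (M : Matrix (Fin N) (Fin N) ℝ) i j

/-- Index set of the entries on or above the diagonal. -/
abbrev UpperIdx (N : ℕ) : Type := {p : Fin N × Fin N // p.1 ≤ p.2}

/-- `s_ij = E |h_ij|²`. -/
def secondMoment {Ω : Type*} [MeasurableSpace Ω] (P : Measure Ω) {N : ℕ} (H : Ω → SymMat N)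
    (i j : Fin N) : ℝ :=
  ∫ ω, |entry (H ω) i j| ^ 2 ∂P

/-- `H` is an `N × N` (real symmetric) generalized Wigner matrix with parameters
`ε, c₁, C₁, C₂`. -/
structure IsGeneralizedWigner {Ω : Type*} [MeasurableSpace Ω] (P : Measure Ω) {N : ℕ}
    (ε c₁ C₁ C₂ : ℝ) (H : Ω → SymMat N) : Prop where
  size_pos : 0 < N
  eps_pos : 0 < ε
  eps_lt_one : ε < 1
  c₁_pos : 0 < c₁
  c₁_lt_one : c₁ < 1
  one_lt_C₁ : 1 < C₁
  one_lt_C₂ : 1 < C₂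
  measurable_entry : ∀ i j, Measurable fun ω => entry (H ω) i j
  /-- the entries on and above the diagonal are mutually independent -/
  indep : iIndepFun (fun (p : UpperIdx N) (ω : Ω) => entry (H ω) p.1.1 p.1.2) P
  /-- the entries are centered (they are integrable by `moment`) -/
  centered : ∀ i j, ∫ ω, entry (H ω) i j ∂P = 0
  variance_lower : ∀ i j, c₁ < N * secondMoment P H i j
  variance_upper : ∀ i j, N * secondMoment P H i j < C₁
  row_sum : ∀ i, |(∑ j, secondMoment P H i j) - 1| < C₁ * (N : ℝ) ^ (-ε)
  moment : ∀ i j,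
    ∫⁻ ω, ENNReal.ofReal (|entry (H ω) i j * √(N : ℝ)| ^ (2 + ε)) ∂P < ENNReal.ofReal C₂

/-- `(B_ij)` is a symmetric family of standard Brownian motions, mutually independent for
`i ≤ j`. -/
structure IsSymmBrownian {Ω : Type*} [MeasurableSpace Ω] (P : Measure Ω) {N : ℕ}
    (B : Fin N → Fin N → ℝ≥0 → Ω → ℝ) : Prop where
  measurable : ∀ i j s, Measurable (B i j s)
  brownian : ∀ i j, IsBrownianReal (B i j) P
  symm : ∀ i j, B i j = B j i
  indep : iIndepFun (fun (p : UpperIdx N) (ω : Ω) (s : ℝ≥0) => B p.1.1 p.1.2 s ω) P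

/-- The matrix process `H_s = {h_ij(s)}` solves, entry by entry, the Ornstein–Uhlenbeck equation
`dh_ij(s) = N^{-1/2} dB_ij(s) - (2 N s_ij)⁻¹ h_ij(s) ds`, where `s_ij = E |h_ij(0)|²`, driven by
Brownian motions that are independent of the initial matrix `H_0`. The noise being additive,
the equation is the pathwise integral equation. -/
structure IsOUFlow {Ω : Type*} [MeasurableSpace Ω] (P : Measure Ω) {N : ℕ}
    (B : Fin N → Fin N → ℝ≥0 → Ω → ℝ) (H : ℝ≥0 → Ω → SymMat N) : Prop where
  measurable_entry : ∀ s i j, Measurable fun ω => entry (H s ω) i j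
  noise : IsSymmBrownian P B
  indep_initial : IndepFun (fun (ω : Ω) (i j : Fin N) => entry (H 0 ω) i j)
    (fun (ω : Ω) (i j : Fin N) (s : ℝ≥0) => B i j s ω) P
  continuous_paths : ∀ᵐ ω ∂P, ∀ i j, Continuous fun s : ℝ≥0 => entry (H s ω) i j
  equation : ∀ᵐ ω ∂P, ∀ i j, ∀ s : ℝ≥0,
    entry (H s ω) i j = entry (H 0 ω) i j + (√(N : ℝ))⁻¹ * B i j s ω
      - (2 * N * secondMoment P (H 0) i j)⁻¹ *
        ∫ u in (0 : ℝ)..s, entry (H u.toNNReal ω) i j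

/-- `X_ij`: the symmetric matrix with entries `1` at `(i, j)` and `(j, i)`, and `0` elsewhere. -/
def X {N : ℕ} (i j : Fin N) : SymMat N :=
  ⟨Matrix.of fun k l => if (k = i ∧ l = j) ∨ (k = j ∧ l = i) then 1 else 0, by
    ext k l
    simp only [Matrix.transpose_apply, Matrix.of_apply]
    congr 1
    simp only [eq_iff_iff]
    tauto⟩

/-- `Θ_ij M`: the matrix `M` with its `(i, j)` and `(j, i)` entries multiplied by `θ`. -/
def Theta {N : ℕ} (i j : Fin N) (θ : ℝ) (M : SymMat N) : SymMat N :=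
  ⟨Matrix.of fun k l =>
      if (k = i ∧ l = j) ∨ (k = j ∧ l = i) then θ * entry M k l else entry M k l, by
    ext k l
    have h : entry M l k = entry M k l := M.2.apply k l
    simp only [Matrix.transpose_apply, Matrix.of_apply, h]
    congr 1
    simp only [eq_iff_iff]
    tauto⟩

/-- The partial derivative `∂_ij F (M) = lim_{y → 0} y⁻¹ (F (M + y X_ij) - F M)`. -/
def pderiv {N : ℕ} (i j : Fin N) (F : SymMat N → ℂ) : SymMat N → ℂ :=
  fun M => lineDeriv ℝ F M (X i j)

/-- `sup_{0 ≤ θ ≤ 1} |∂_ij^k F (Θ_ij M)|`. -/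
def supPderiv {N : ℕ} (i j : Fin N) (k : ℕ) (F : SymMat N → ℂ) (M : SymMat N) : ℝ≥0∞ :=
  ⨆ θ ∈ Set.Icc (0 : ℝ) 1, ‖((pderiv i j)^[k] F) (Theta i j θ M)‖ₑ

/-- The quantity `Ξ` of a random symmetric matrix `M`, for the variance profile `s` and the
truncation level `N ^ (-ε / 10)`. Its value is `∞` if one of the expectations is infinite. -/
def Xi {Ω : Type*} [MeasurableSpace Ω] (P : Measure Ω) {N : ℕ} (ε : ℝ)
    (s : Fin N → Fin N → ℝ) (F : SymMat N → ℂ) (M : Ω → SymMat N) : ℝ≥0∞ :=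
  ⨆ (i : Fin N) (j : Fin N),
    (ENNReal.ofReal (s i j)⁻¹ * (∫⁻ ω in {ω | (N : ℝ) ^ (-ε / 10) ≤ |entry (M ω) i j|},
        ‖entry (M ω) i j‖ₑ * supPderiv i j 1 F (M ω) ∂P)
    + ENNReal.ofReal (s i j)⁻¹ * (∫⁻ ω in {ω | (N : ℝ) ^ (-ε / 10) ≤ |entry (M ω) i j|},
        ‖entry (M ω) i j‖ₑ ^ 2 * supPderiv i j 2 F (M ω) ∂P)
    + (∫⁻ ω in {ω | (N : ℝ) ^ (-ε / 10) ≤ |entry (M ω) i j|},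
        supPderiv i j 2 F (M ω) ∂P)
    + ENNReal.ofReal (s i j)⁻¹ * (∫⁻ ω in {ω | |entry (M ω) i j| < (N : ℝ) ^ (-ε / 10)},
        ‖entry (M ω) i j‖ₑ ^ 3 * supPderiv i j 3 F (M ω) ∂P)
    + (∫⁻ ω in {ω | |entry (M ω) i j| < (N : ℝ) ^ (-ε / 10)},
        ‖entry (M ω) i j‖ₑ * supPderiv i j 3 F (M ω) ∂P))

end WignerFlow

end

/-! On and above the diagonal, the entries of `H_s` are independent Ornstein–Uhlenbeck processes
with drift rate `a = (2 N s_ij)⁻¹` and noise coefficient `c = N^{-1/2}`. Since `c² = 2 a s_ij`, the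
stationary variance is `s_ij`, which is also the initial variance. Hence every entry stays centered
with variance `s_ij` at all times (`integral_id_ouLaw`, `integral_sq_ouLaw`).

For a nice test function `G` the forward equation (`hasDerivWithinAt_integral_pi_ouLaw`) says that
`E G` has time derivative `∑ a_p E[s_p ∂_p² G - x_p ∂_p G]`. Expanding around `x_p = 0` leaves `s_p
∂_p² G - x_p ∂_p G - x_p² ∂_p² G`, with derivatives taken at a point that does not involve `x_p`. By
independence its mean is zero. The error is of third order where `x_p` is small, and is estimated by
the triangle inequality where `x_p` is large; altogether it is at most `2 s_p Ξ`
(`enorm_integral_generator_le`). As `2 a_p s_p = 1 / N` and there are at most `N²` coordinates, the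
derivative is at most `N Ξ`.

No stochastic calculus is needed. The noise is additive, so each path is a limit of
Riemann–Stieltjes sums, whose laws are explicit (`tendsto_expSum`, `map_ou_process`); the forward
equation then follows from the semigroup property and a Gaussian Taylor expansion.

Since `F` may be unbounded, the argument is run on `F` times a box cutoff of radius `R`. The terms
in which a derivative hits the cutoff live on `R ≤ |x_p|`. Those with `F` are small by uniform
integrability and Chebyshev; those with `∂_p F` carry a factor `1 / R` against the first term of `Ξ`
(`norm_integral_pi_ouLaw_sub_le`). -/

namespace WignerFlow

open Filter Topology

/-! ### Pathwise variation of constants. -/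

/-- The exponentially weighted Riemann–Stieltjes sum of `b` over the uniform partition of `[0, t]`
into `n` intervals. -/
noncomputable def expSum (a t : ℝ) (n : ℕ) (b : ℝ → ℝ) : ℝ :=
  ∑ k ∈ Finset.range n,
    Real.exp (-a * (t - k * t / n)) * (b ((k + 1 : ℕ) * t / n) - b (k * t / n))

/-- Summation by parts: `exp (-a (t - s)) * Y s` telescopes over the partition, and the equation
turns each increment of `Y` into one of `b` minus `a ∫ Y`. Regularity is asked of `Y` only, so `b`
may be a Brownian path. -/
theorem sub_expSum_eq {a c y₀ t : ℝ} (ht : 0 ≤ t) {Y b : ℝ → ℝ} (hY : Continuous Y)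
    (h : ∀ s, 0 ≤ s → Y s = y₀ + c * b s - a * ∫ u in (0 : ℝ)..s, Y u) {n : ℕ} (hn : n ≠ 0) :
    Y t - (Real.exp (-a * t) * Y 0 + c * expSum a t n b) =
      ∑ k ∈ Finset.range n, ∫ u in (k * t / n)..((k + 1 : ℕ) * t / n),
        a * (Real.exp (-a * (t - u)) * Y ((k + 1 : ℕ) * t / n)
          - Real.exp (-a * (t - k * t / n)) * Y u) := by
  have hn' : (n : ℝ) ≠ 0 := by exact_mod_cast hn
  have htele := Finset.sum_range_sub
    (fun k : ℕ => Real.exp (-a * (t - k * t / n)) * Y (k * t / n)) n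
  simp only [mul_div_cancel_left₀ t hn', sub_self, mul_zero, Real.exp_zero, one_mul,
    Nat.cast_zero, zero_mul, zero_div, sub_zero] at htele
  rw [← sub_sub, ← htele, expSum, Finset.mul_sum, ← Finset.sum_sub_distrib]
  refine Finset.sum_congr rfl fun k _ => ?_
  set p : ℝ := k * t / n
  set q : ℝ := (k + 1 : ℕ) * t / n
  have hp : 0 ≤ p := by positivity
  have hq : 0 ≤ q := by positivity
  have hexp : ∫ u in p..q, a * Real.exp (-a * (t - u)) =
      Real.exp (-a * (t - q)) - Real.exp (-a * (t - p)) := by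
    refine intervalIntegral.integral_eq_sub_of_hasDerivAt
      (f := fun u => Real.exp (-a * (t - u))) (fun u _ => ?_)
      (Continuous.intervalIntegrable (by fun_prop) _ _)
    have := (((hasDerivAt_id u).const_sub t).const_mul (-a)).exp
    simpa [mul_comm] using this
  have hY' : ∫ u in p..q, Y u = (∫ u in (0 : ℝ)..q, Y u) - ∫ u in (0 : ℝ)..p, Y u :=
    (intervalIntegral.integral_interval_sub_left (hY.intervalIntegrable _ _)
      (hY.intervalIntegrable _ _)).symm
  have hint : ∫ u in p..q, a * (Real.exp (-a * (t - u)) * Y q - Real.exp (-a * (t - p)) * Y u) =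
      (Real.exp (-a * (t - q)) - Real.exp (-a * (t - p))) * Y q
        - Real.exp (-a * (t - p)) * a * ∫ u in p..q, Y u := by
    rw [← hexp, ← intervalIntegral.integral_mul_const, ← intervalIntegral.integral_const_mul,
      ← intervalIntegral.integral_sub]
    · congr 1; ext u; ring
    · exact Continuous.intervalIntegrable (by fun_prop) _ _
    · exact Continuous.intervalIntegrable (by fun_prop) _ _
  rw [hint, hY']
  have h1 := h p hp
  have h2 := h q hq
  linear_combination Real.exp (-a * (t - p)) * (h2 - h1)

/-- Variation of constants for the equation `dY = c db - a Y ds`, the integral against `b` being a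
limit of Riemann–Stieltjes sums. -/
theorem tendsto_expSum {a c y₀ t : ℝ} (ht : 0 ≤ t) {Y b : ℝ → ℝ} (hY : Continuous Y)
    (h : ∀ s, 0 ≤ s → Y s = y₀ + c * b s - a * ∫ u in (0 : ℝ)..s, Y u) :
    Tendsto (fun n : ℕ => Real.exp (-a * t) * Y 0 + c * expSum a t n b) atTop (𝓝 (Y t)) := by
  have huc : UniformContinuousOn (fun z : ℝ × ℝ => Real.exp (-a * (t - z.1)) * Y z.2)
      (Set.Icc 0 t ×ˢ Set.Icc 0 t) :=
    (isCompact_Icc.prod isCompact_Icc).uniformContinuousOn_of_continuous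
      (Continuous.continuousOn (by fun_prop))
  rw [Metric.uniformContinuousOn_iff] at huc
  rw [Metric.tendsto_atTop]
  intro ε hε
  -- The integrand in `sub_expSum_eq` is `a` times the difference of this function at `(u, q)` and
  -- `(p, u)`. Summing over the partition costs a factor `|a| * t`; the `+ 1` covers the case where
  -- that factor is zero.
  obtain ⟨δ, hδ, hd⟩ := huc (ε / (|a| * t + 1)) (by positivity)
  obtain ⟨n₀, hn₀⟩ := exists_nat_gt (t / δ)
  refine ⟨max n₀ 1, fun n hn => ?_⟩
  have hn1 : n ≠ 0 := by have := le_max_right n₀ 1; omega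
  have hnpos : (0 : ℝ) < n := by exact_mod_cast Nat.pos_of_ne_zero hn1
  have hnδ : t / n < δ := by
    have : (n₀ : ℝ) ≤ n := by exact_mod_cast (le_max_left n₀ 1).trans hn
    rw [div_lt_iff₀ hnpos]
    rw [div_lt_iff₀ hδ] at hn₀
    nlinarith
  rw [dist_comm, Real.dist_eq, sub_expSum_eq ht hY h hn1]
  have hterm : ∀ k ∈ Finset.range n, |∫ u in (k * t / n)..((k + 1 : ℕ) * t / n),
        a * (Real.exp (-a * (t - u)) * Y ((k + 1 : ℕ) * t / n)
          - Real.exp (-a * (t - k * t / n)) * Y u)| ≤ |a| * (ε / (|a| * t + 1)) * (t / n) := by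
    intro k hk
    have hk' : ((k + 1 : ℕ) : ℝ) ≤ n := by exact_mod_cast Finset.mem_range.1 hk
    set p : ℝ := k * t / n with hp_def
    set q : ℝ := (k + 1 : ℕ) * t / n with hq_def
    have hpq : q - p = t / n := by rw [hp_def, hq_def]; push_cast; ring
    have htn : 0 ≤ t / n := by positivity
    have hp : 0 ≤ p := by positivity
    have hq : q ≤ t := by rw [hq_def, div_le_iff₀ hnpos]; nlinarith
    have hqm : q ∈ Set.Icc 0 t := ⟨by positivity, hq⟩
    have hpm : p ∈ Set.Icc 0 t := ⟨hp, by linarith⟩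
    have habs : t / n = |q - p| := by rw [hpq, abs_of_nonneg htn]
    rw [habs, ← Real.norm_eq_abs]
    refine intervalIntegral.norm_integral_le_of_norm_le_const fun u hu => ?_
    · rw [Set.uIoc_of_le (by linarith)] at hu
      have hum : u ∈ Set.Icc 0 t := ⟨by linarith [hu.1], by linarith [hu.2]⟩
      rw [Real.norm_eq_abs, abs_mul]
      refine mul_le_mul_of_nonneg_left ?_ (abs_nonneg a)
      refine (hd (u, q) ⟨hum, hqm⟩ (p, u) ⟨hpm, hum⟩ ?_).le
      rw [Prod.dist_eq, max_lt_iff, Real.dist_eq, Real.dist_eq, abs_lt, abs_lt]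
      refine ⟨⟨?_, ?_⟩, ?_, ?_⟩ <;> dsimp only <;> linarith [hu.1, hu.2]
  refine (Finset.abs_sum_le_sum_abs _ _).trans_lt ((Finset.sum_le_sum hterm).trans_lt ?_)
  rw [Finset.sum_const, Finset.card_range, nsmul_eq_mul]
  have : (n : ℝ) * (|a| * (ε / (|a| * t + 1)) * (t / n)) = ε * ((|a| * t) / (|a| * t + 1)) := by
    field_simp
  rw [this]
  have h1 : (|a| * t) / (|a| * t + 1) < 1 := by rw [div_lt_one (by positivity)]; linarith
  nlinarith

/-- The limit variance of an Ornstein–Uhlenbeck process at time `t`. -/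
theorem tendsto_expSum_id {a t : ℝ} (ha : a ≠ 0) (ht : 0 ≤ t) :
    Tendsto (fun n : ℕ => expSum (2 * a) t n id) atTop
      (𝓝 ((1 - Real.exp (-(2 * a) * t)) / (2 * a))) := by
  -- The variance of a unit-noise process started at a point solves `v' = 1 - 2 a v`: the same
  -- equation with rate `2 * a`, driven by the identity.
  have h := tendsto_expSum (a := 2 * a) (c := 1) (y₀ := 0) (b := id) ht
    (Y := fun s => (1 - Real.exp (-(2 * a) * s)) / (2 * a)) (by fun_prop) fun s _ => ?_
  · simpa using h
  · have : ∫ u in (0 : ℝ)..s, (1 - Real.exp (-(2 * a) * u)) / (2 * a) =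
        (s / (2 * a) + Real.exp (-(2 * a) * s) / (2 * a) ^ 2)
        - (0 / (2 * a) + Real.exp (-(2 * a) * 0) / (2 * a) ^ 2) := by
      refine intervalIntegral.integral_eq_sub_of_hasDerivAt
        (f := fun u => u / (2 * a) + Real.exp (-(2 * a) * u) / (2 * a) ^ 2) (fun u _ => ?_)
        (Continuous.intervalIntegrable (by fun_prop) _ _)
      have := ((hasDerivAt_id u).div_const (2 * a)).add
        ((((hasDerivAt_id u).const_mul (-(2 * a))).exp).div_const ((2 * a) ^ 2))
      refine this.congr_deriv ?_
      simp only [id]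
      field_simp
      ring
    rw [this]
    simp only [mul_zero, Real.exp_zero, id]
    field_simp
    ring

/-! ### Law of the Ornstein–Uhlenbeck flow and its semigroup property. -/

variable {Ω : Type*} [MeasurableSpace Ω] {P : Measure Ω}

theorem map_sum_gaussianReal [IsProbabilityMeasure P] {κ : Type*} {X : κ → Ω → ℝ} {v : κ → ℝ≥0}
    (hind : iIndepFun X P) (hm : ∀ k, Measurable (X k))
    (hX : ∀ k, P.map (X k) = gaussianReal 0 (v k)) (s : Finset κ) :
    P.map (fun ω => ∑ k ∈ s, X k ω) = gaussianReal 0 (∑ k ∈ s, v k) := by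
  classical
  induction s using Finset.induction_on with
  | empty => simp
  | insert k s hk ih =>
    have h := gaussianReal_add_gaussianReal_of_indepFun
      (hind.indepFun_finsetSum_of_notMem hm hk) (m₁ := 0) (m₂ := 0)
      (v₁ := ∑ k ∈ s, v k) (v₂ := v k) (by convert ih; simp) (hX k)
    simp only [Finset.sum_insert hk]
    rw [add_zero, add_comm (∑ k ∈ s, v k)] at h
    rw [← h]
    congr 1
    ext ω
    simp [add_comm]

theorem measurable_expSum {B : ℝ≥0 → Ω → ℝ} (hm : ∀ s, Measurable (B s)) (a t : ℝ) (n : ℕ) :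
    Measurable fun ω => expSum a t n fun s => B s.toNNReal ω := by
  unfold expSum
  fun_prop

theorem measurable_expSum_path (a t : ℝ) (n : ℕ) :
    Measurable fun b : ℝ≥0 → ℝ => expSum a t n fun s => b s.toNNReal := by
  unfold expSum
  fun_prop

/-- The increments are independent Gaussians whose variances are the interval lengths, and squaring
the weights doubles the rate. So the variance of the sum is again an `expSum`, with rate `2 * a` and
the identity as path. -/
theorem map_expSum_brownian [IsProbabilityMeasure P] {B : ℝ≥0 → Ω → ℝ}
    (hB : IsPreBrownianReal B P) (hm : ∀ s, Measurable (B s)) (a : ℝ) {t : ℝ} (ht : 0 ≤ t)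
    (n : ℕ) :
    P.map (fun ω => expSum a t n fun s => B s.toNNReal ω) =
      gaussianReal 0 (expSum (2 * a) t n id).toNNReal := by
  have hmono : Monotone fun k : ℕ => (k * t / n : ℝ).toNNReal := by
    intro k l hkl
    apply Real.toNNReal_mono
    gcongr
  have hind := (hB.hasIndepIncrements.nat hmono).comp
    (fun k x => Real.exp (-a * (t - k * t / n)) * x) fun k => by fun_prop
  have hlaw : ∀ k : ℕ, P.map ((fun x => Real.exp (-a * (t - k * t / n)) * x) ∘
      fun ω => B ((k + 1 : ℕ) * t / n : ℝ).toNNReal ω - B (k * t / n : ℝ).toNNReal ω) =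
      gaussianReal 0 (Real.exp (-(2 * a) * (t - k * t / n)) *
        ((k + 1 : ℕ) * t / n - k * t / n)).toNNReal := by
    intro k
    have h1 := gaussianReal_const_mul (hB.hasLaw_sub ((k + 1 : ℕ) * t / n : ℝ).toNNReal
      (k * t / n : ℝ).toNNReal) (Real.exp (-a * (t - k * t / n)))
    have h2 := h1.map_eq
    rw [mul_zero] at h2
    refine h2.trans ?_
    congr 1
    have hle : (k * t / n : ℝ) ≤ (k + 1 : ℕ) * t / n := by gcongr; simp
    ext
    rw [Real.coe_toNNReal _ (mul_nonneg (Real.exp_pos _).le (sub_nonneg.2 hle)), NNReal.coe_mul,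
      coe_nndist, Real.dist_eq]
    simp only [NNReal.val_eq_coe, NNReal.coe_mk]
    rw [Real.coe_toNNReal _ (by positivity), Real.coe_toNNReal _ (by positivity),
      abs_of_nonneg (sub_nonneg.2 hle), ← Real.exp_nat_mul]
    congr 2
    push_cast
    ring
  have := map_sum_gaussianReal hind (fun k => by fun_prop) hlaw (Finset.range n)
  simp only [Function.comp_apply] at this
  rw [expSum, Real.toNNReal_sum_of_nonneg]
  · exact this
  · intro k _
    refine mul_nonneg (Real.exp_pos _).le (sub_nonneg.2 ?_)
    simp only [id]
    gcongr
    simp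

/-- The value at time `t` of an Ornstein–Uhlenbeck process with drift `-a y`, stationary
variance `s`, starting point `z.1` and standardised noise `z.2`. -/
noncomputable def ouStep (a s t : ℝ) (z : ℝ × ℝ) : ℝ :=
  Real.exp (-a * t) * z.1 + √(s * (1 - Real.exp (-(2 * a) * t))) * z.2

@[fun_prop]
theorem continuous_ouStep (a s t : ℝ) : Continuous (ouStep a s t) := by
  unfold ouStep; fun_prop

/-- The law at time `t` of an Ornstein–Uhlenbeck process with initial law `ν`. -/
noncomputable def ouLaw (a s t : ℝ) (ν : Measure ℝ) : Measure ℝ :=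
  (ν.prod (gaussianReal 0 1)).map (ouStep a s t)

instance (a s t : ℝ) (ν : Measure ℝ) [IsProbabilityMeasure ν] :
    IsProbabilityMeasure (ouLaw a s t ν) :=
  Measure.isProbabilityMeasure_map (by fun_prop)

theorem map_prod_pi_ouStep {ι : Type*} [Fintype ι] (a s : ι → ℝ) (t : ℝ) (ν : ι → Measure ℝ)
    [∀ p, IsProbabilityMeasure (ν p)] :
    ((Measure.pi ν).prod (Measure.pi fun _ : ι => gaussianReal 0 1)).map
      (fun z p => ouStep (a p) (s p) t (z.1 p, z.2 p)) =
      Measure.pi fun p => ouLaw (a p) (s p) t (ν p) := by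
  have h := measurePreserving_arrowProdEquivProdArrow ℝ ℝ ι ν fun _ => gaussianReal 0 1
  rw [← h.map_eq, Measure.map_map (by fun_prop) (by fun_prop)]
  exact Measure.pi_map_pi fun p => by fun_prop

theorem gaussianReal_eq_map_sqrt (v : ℝ≥0) :
    gaussianReal 0 v = (gaussianReal 0 1).map fun x => √(v : ℝ) * x := by
  rw [gaussianReal_map_const_mul, mul_zero, mul_one]
  congr
  ext
  simp

/-- The joint law of the initial data and the discretised noise. -/
theorem map_initial_expSum [IsProbabilityMeasure P] {ι : Type*} [Fintype ι]
    {W : ι → Ω → ℝ} {B : ι → ℝ≥0 → Ω → ℝ} (a : ι → ℝ)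
    (hW : ∀ p, Measurable (W p)) (hBm : ∀ p u, Measurable (B p u))
    (hB : ∀ p, IsPreBrownianReal (B p) P)
    (hBind : iIndepFun (fun p ω u => B p u ω) P) (hWind : iIndepFun W P)
    (hind : IndepFun (fun ω p => W p ω) (fun ω p u => B p u ω) P) {t : ℝ} (ht : 0 ≤ t) (n : ℕ) :
    P.map (fun ω => ((fun p => W p ω), fun p => expSum (a p) t n fun u => B p u.toNNReal ω)) =
      ((Measure.pi fun p => P.map (W p)).prod (Measure.pi fun _ : ι => gaussianReal 0 1)).map
        fun z => (z.1, fun p => √(expSum (2 * a p) t n id) * z.2 p) := by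
  have hprob : ∀ p, IsProbabilityMeasure (P.map (W p)) := fun p =>
    Measure.isProbabilityMeasure_map (hW p).aemeasurable
  have hψ : Measurable fun (b : ι → ℝ≥0 → ℝ) p => expSum (a p) t n fun u => b p u.toNNReal :=
    measurable_pi_lambda _ fun p => (measurable_expSum_path _ _ _).comp (measurable_pi_apply p)
  have hZm : ∀ p, Measurable fun ω => expSum (a p) t n fun u => B p u.toNNReal ω :=
    fun p => measurable_expSum (hBm p) _ _ _
  have hi : IndepFun (fun ω p => W p ω)
      (fun ω p => expSum (a p) t n fun u => B p u.toNNReal ω) P := hind.comp measurable_id hψ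
  have hZi : iIndepFun (fun p ω => expSum (a p) t n fun u => B p u.toNNReal ω) P :=
    hBind.comp _ fun p => measurable_expSum_path (a p) t n
  rw [(indepFun_iff_map_prod_eq_prod_map_map (measurable_pi_lambda _ hW).aemeasurable
    (measurable_pi_lambda _ hZm).aemeasurable).1 hi,
    (iIndepFun_iff_map_fun_eq_pi_map fun p => (hW p).aemeasurable).1 hWind,
    (iIndepFun_iff_map_fun_eq_pi_map fun p => (hZm p).aemeasurable).1 hZi]
  have : ∀ p, P.map (fun ω => expSum (a p) t n fun u => B p u.toNNReal ω) =
      (gaussianReal 0 1).map fun x => √(expSum (2 * a p) t n id) * x := by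
    intro p
    rw [map_expSum_brownian (hB p) (hBm p) _ ht, gaussianReal_eq_map_sqrt, Real.coe_toNNReal']
    congr 1
    ext x
    -- The truncation to `ℝ≥0` and the real square root both send negative numbers to `0`, so the
    -- sign of the sum need not be discussed.
    rcases le_total 0 (expSum (2 * a p) t n id) with h | h
    · rw [max_eq_left h]
    · rw [max_eq_right h, Real.sqrt_zero, Real.sqrt_eq_zero_of_nonpos h]
  simp_rw [this]
  have hprob2 : ∀ p, IsProbabilityMeasure
      ((gaussianReal 0 1).map fun x => √(expSum (2 * a p) t n id) * x) :=
    fun p => Measure.isProbabilityMeasure_map (by fun_prop)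
  rw [← Measure.pi_map_pi (f := fun p x => √(expSum (2 * a p) t n id) * x) fun p => by fun_prop]
  have h := Measure.map_prod_map (Measure.pi fun p => P.map (W p))
    (Measure.pi fun _ : ι => gaussianReal 0 1) measurable_id
    (g := fun (x : ι → ℝ) p => √(expSum (2 * a p) t n id) * x p) (by fun_prop)
  rw [Measure.map_id] at h
  exact h

/-- Bounded continuous functions determine the law. Their expectations along the Riemann sums have
two limits: the one given by pathwise convergence to the solution, and the one given by the explicit
Gaussian laws with converging variances. Hypothesis `hcs` identifies `s p` as the stationary
variance. -/
theorem map_ou_process [IsProbabilityMeasure P] {ι : Type*} [Fintype ι]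
    {y B : ι → ℝ≥0 → Ω → ℝ} {a s c : ι → ℝ} (ha : ∀ p, 0 < a p) (hc : ∀ p, 0 ≤ c p)
    (hcs : ∀ p, c p ^ 2 = 2 * a p * s p)
    (hy : ∀ p u, Measurable (y p u)) (hBm : ∀ p u, Measurable (B p u))
    (hB : ∀ p, IsPreBrownianReal (B p) P)
    (hBind : iIndepFun (fun p ω u => B p u ω) P) (hyind : iIndepFun (fun p => y p 0) P)
    (hind : IndepFun (fun ω p => y p 0 ω) (fun ω p u => B p u ω) P)
    (hcont : ∀ᵐ ω ∂P, ∀ p, Continuous fun u => y p u ω)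
    (heq : ∀ᵐ ω ∂P, ∀ p, ∀ u : ℝ≥0, y p u ω =
      y p 0 ω + c p * B p u ω - a p * ∫ r in (0 : ℝ)..u, y p r.toNNReal ω) (t : ℝ≥0) :
    P.map (fun ω p => y p t ω) = Measure.pi fun p => ouLaw (a p) (s p) t (P.map (y p 0)) := by
  have hprob : ∀ p u, IsProbabilityMeasure (P.map (y p u)) := fun p u =>
    Measure.isProbabilityMeasure_map (hy p u).aemeasurable
  have hprob' : IsProbabilityMeasure (P.map fun ω p => y p t ω) :=
    Measure.isProbabilityMeasure_map (by fun_prop)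
  rw [← map_prod_pi_ouStep]
  have hstep : Measurable fun (z : (ι → ℝ) × (ι → ℝ)) p => ouStep (a p) (s p) t (z.1 p, z.2 p) := by
    fun_prop
  have := Measure.isProbabilityMeasure_map (μ := (Measure.pi fun p => P.map (y p 0)).prod
    (Measure.pi fun _ : ι => gaussianReal 0 1)) hstep.aemeasurable
  refine ext_of_forall_integral_eq_of_IsFiniteMeasure fun f => ?_
  rw [integral_map (by fun_prop) (by fun_prop), integral_map (by fun_prop) (by fun_prop)]
  set Z : ℕ → Ω → ι → ℝ := fun n ω p => expSum (a p) t n fun u => B p u.toNNReal ω with hZ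
  have hZm : ∀ n, Measurable (Z n) := fun n =>
    measurable_pi_lambda _ fun p => measurable_expSum (hBm p) _ _ _
  set v : ℕ → ι → ℝ := fun n p => expSum (2 * a p) t n id
  have hlaw := fun n => map_initial_expSum a (fun p => hy p 0) hBm hB hBind hyind hind t.coe_nonneg n
  set A : ℕ → Ω → ι → ℝ := fun n ω p => Real.exp (-a p * t) * y p 0 ω + c p * Z n ω p
  have hlim1 : Tendsto (fun n => ∫ ω, f (A n ω) ∂P) atTop (𝓝 (∫ ω, f (fun p => y p t ω) ∂P)) := by
    refine tendsto_integral_of_dominated_convergence (fun _ => ‖f‖) (fun n => ?_)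
      (integrable_const _) (fun n => .of_forall fun ω => f.norm_coe_le_norm _) ?_
    · exact (f.continuous.measurable.comp (by fun_prop)).aestronglyMeasurable
    · filter_upwards [hcont, heq] with ω hω1 hω2
      refine (f.continuous.tendsto _).comp (tendsto_pi_nhds.2 fun p => ?_)
      have := tendsto_expSum (a := a p) (c := c p) (y₀ := y p 0 ω) t.coe_nonneg
        (Y := fun u => y p u.toNNReal ω) (b := fun u => B p u.toNNReal ω)
        ((hω1 p).comp continuous_real_toNNReal) fun u hu => by
          have := hω2 p u.toNNReal
          rwa [Real.coe_toNNReal u hu] at this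
      rwa [Real.toNNReal_zero, Real.toNNReal_coe] at this
  have hlim2 : Tendsto (fun n => ∫ ω, f (A n ω) ∂P) atTop
      (𝓝 (∫ z, f (fun p => ouStep (a p) (s p) t (z.1 p, z.2 p))
        ∂((Measure.pi fun p => P.map (y p 0)).prod (Measure.pi fun _ : ι => gaussianReal 0 1)))) := by
    have hA : ∀ n, ∫ ω, f (A n ω) ∂P =
        ∫ z, f (fun p => Real.exp (-a p * t) * z.1 p + c p * (√(v n p) * z.2 p))
        ∂((Measure.pi fun p => P.map (y p 0)).prod (Measure.pi fun _ : ι => gaussianReal 0 1)) := by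
      intro n
      have h1 := integral_map (μ := P) (φ := fun ω => ((fun p => y p 0 ω), Z n ω)) (by fun_prop)
        (f := fun z : (ι → ℝ) × (ι → ℝ) => f fun p => Real.exp (-a p * t) * z.1 p + c p * z.2 p)
        (Continuous.aestronglyMeasurable (by fun_prop))
      erw [hlaw n, integral_map (by fun_prop)
        (Continuous.aestronglyMeasurable (by fun_prop))] at h1
      exact h1.symm
    simp_rw [hA]
    refine tendsto_integral_of_dominated_convergence (fun _ => ‖f‖) (fun n => ?_)
      (integrable_const _) (fun n => .of_forall fun ω => f.norm_coe_le_norm _)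
      (.of_forall fun z => (f.continuous.tendsto _).comp (tendsto_pi_nhds.2 fun p => ?_))
    · exact Continuous.aestronglyMeasurable (by fun_prop)
    · have h1 := (tendsto_expSum_id (ha p).ne' t.coe_nonneg).sqrt.const_mul (c p)
      have h2 : c p * √((1 - Real.exp (-(2 * a p) * t)) / (2 * a p)) =
          √(s p * (1 - Real.exp (-(2 * a p) * t))) := by
        nth_rewrite 1 [← Real.sqrt_sq (hc p)]
        rw [← Real.sqrt_mul (sq_nonneg _), hcs]
        congr 1
        have := (ha p).ne'
        field_simp
      have h3 := (h1.mul_const (z.2 p)).const_add (Real.exp (-a p * t) * z.1 p)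
      erw [h2] at h3
      simp only [mul_assoc (c p)] at h3
      exact h3
  exact tendsto_nhds_unique hlim1 hlim2

/-- The law is the rescaled initial law convolved with a centered Gaussian, and the variances add up
since `e^{-2au} (1 - e^{-2at}) + (1 - e^{-2au}) = 1 - e^{-2a(t+u)}`. -/
theorem ouLaw_add {a s : ℝ} (ha : 0 ≤ a) (hs : 0 ≤ s) {t u : ℝ} (ht : 0 ≤ t) (hu : 0 ≤ u)
    (ν : Measure ℝ) [IsProbabilityMeasure ν] :
    ouLaw a s u (ouLaw a s t ν) = ouLaw a s (t + u) ν := by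
  have key : ∀ (t : ℝ), 0 ≤ t → ∀ (ν : Measure ℝ) [IsProbabilityMeasure ν], ouLaw a s t ν =
      (ν.map fun x => Real.exp (-a * t) * x) ∗
        gaussianReal 0 (s * (1 - Real.exp (-(2 * a) * t))).toNNReal := by
    intro t ht ν _
    have hn : 0 ≤ s * (1 - Real.exp (-(2 * a) * t)) := by
      refine mul_nonneg hs (sub_nonneg.2 (Real.exp_le_one_iff.2 ?_))
      nlinarith
    rw [gaussianReal_eq_map_sqrt, Measure.conv, Measure.map_prod_map _ _ (by fun_prop)
      (by fun_prop), Measure.map_map (by fun_prop) (by fun_prop), Real.coe_toNNReal _ hn]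
    rfl
  have := Measure.isProbabilityMeasure_map (μ := ν)
    (f := fun x => Real.exp (-a * t) * x) (by fun_prop)
  rw [key u hu, key t ht, key (t + u) (by positivity)]
  have hmap := Measure.map_conv_addMonoidHom (μ := ν.map fun x => Real.exp (-a * t) * x)
    (ν := gaussianReal 0 (s * (1 - Real.exp (-(2 * a) * t))).toNNReal)
    (AddMonoidHom.mulLeft (Real.exp (-a * u))) (measurable_const_mul _)
  simp only [AddMonoidHom.coe_mulLeft] at hmap
  rw [hmap, Measure.map_map (by fun_prop) (by fun_prop)]
  have hg := gaussianReal_map_const_mul (μ := 0)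
    (v := (s * (1 - Real.exp (-(2 * a) * t))).toNNReal) (Real.exp (-a * u))
  rw [hg, Measure.conv_assoc, gaussianReal_conv_gaussianReal]
  have hn : ∀ r, 0 ≤ r → 0 ≤ s * (1 - Real.exp (-(2 * a) * r)) := fun r hr => by
    refine mul_nonneg hs (sub_nonneg.2 (Real.exp_le_one_iff.2 ?_))
    nlinarith
  congr 1
  · congr 1
    ext x
    simp only [Function.comp_apply]
    rw [← mul_assoc, ← Real.exp_add]
    ring_nf
  · congr 1
    · simp
    ext
    simp only [NNReal.coe_add, NNReal.coe_mul, NNReal.coe_mk]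
    rw [Real.coe_toNNReal _ (hn t ht), Real.coe_toNNReal _ (hn u hu),
      Real.coe_toNNReal _ (hn (t + u) (by positivity)), ← Real.exp_nat_mul,
      show -(2 * a) * (t + u) = -(2 * a) * t + -(2 * a) * u by ring, Real.exp_add,
      show ((2 : ℕ) : ℝ) * (-a * u) = -(2 * a) * u by push_cast; ring]
    ring

/-! ### Taylor expansion under a small Gaussian perturbation. -/

section Taylor

variable {E : Type*} [NormedAddCommGroup E] [NormedSpace ℝ E]

/-- Two mean value inequalities along the segment: one for the first derivative minus its linear
part, one for the function itself. The constant is not sharp. -/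
theorem norm_taylor_two_le {G : E → ℂ} {D : E → E →L[ℝ] ℂ} {D2 : E → E →L[ℝ] E →L[ℝ] ℂ}
    (hG : ∀ x, HasFDerivAt G (D x) x) (hD : ∀ x, HasFDerivAt D (D2 x) x) {K : ℝ≥0}
    (hK : LipschitzWith K D2) (y w : E) :
    ‖G (y + w) - G y - D y w - (1 / 2 : ℝ) • D2 y w w‖ ≤ K * ‖w‖ ^ 3 := by
  have hline : ∀ r : ℝ, HasDerivAt (fun r : ℝ => y + r • w) w r := fun r => by
    simpa using ((hasDerivAt_id r).smul_const w).const_add y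
  set q : ℝ → ℂ := fun r => D (y + r • w) w - r • D2 y w w with hq_def
  have hq : ∀ r, HasDerivAt q (D2 (y + r • w) w w - D2 y w w) r := fun r => by
    have h1 : HasDerivAt (fun r : ℝ => D (y + r • w)) (D2 (y + r • w) w) r :=
      (hD (y + r • w)).comp_hasDerivAt r (hline r)
    have h2 : HasDerivAt (fun r : ℝ => D (y + r • w) w) (D2 (y + r • w) w w) r := by
      simpa using h1.clm_apply (hasDerivAt_const r w)
    have h3 : HasDerivAt (fun r : ℝ => r • D2 y w w) (D2 y w w) r := by
      simpa using (hasDerivAt_id r).smul_const (D2 y w w)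
    exact h2.sub h3
  have hqb : ∀ r ∈ Set.Icc (0 : ℝ) 1, ‖q r - q 0‖ ≤ K * ‖w‖ ^ 3 := by
    intro r hr
    have := norm_image_sub_le_of_norm_deriv_le_segment' (f := q) (C := K * ‖w‖ ^ 3)
      (fun r _ => (hq r).hasDerivWithinAt) (fun u hu => ?_) r hr
    · refine this.trans ?_
      have : 0 ≤ K * ‖w‖ ^ 3 := by positivity
      nlinarith [hr.1, hr.2]
    · have h1 := hK.norm_sub_le (y + u • w) y
      rw [add_sub_cancel_left, norm_smul, Real.norm_of_nonneg hu.1] at h1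
      have h2 : ‖(D2 (y + u • w) - D2 y) w w‖ ≤ ‖D2 (y + u • w) - D2 y‖ * ‖w‖ * ‖w‖ :=
        ContinuousLinearMap.le_opNorm₂ _ _ _
      have h3 : (K : ℝ) * (u * ‖w‖) ≤ K * ‖w‖ := by
        refine mul_le_mul_of_nonneg_left ?_ K.2
        have := norm_nonneg w
        nlinarith [hu.2]
      calc _ ≤ _ := h2
        _ ≤ (K * ‖w‖) * ‖w‖ * ‖w‖ := by gcongr; exact h1.trans h3
        _ = _ := by ring
  have hh : ∀ r : ℝ, HasDerivAt (fun r : ℝ => G (y + r • w) - r • D y w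
      - (r ^ 2 / 2 : ℝ) • D2 y w w) (q r - q 0) r := fun r => by
    have h1 : HasDerivAt (fun r : ℝ => G (y + r • w)) (D (y + r • w) w) r :=
      (hG (y + r • w)).comp_hasDerivAt r (hline r)
    have h2 : HasDerivAt (fun r : ℝ => r • D y w) (D y w) r := by
      simpa using (hasDerivAt_id r).smul_const (D y w)
    have h3 : HasDerivAt (fun r : ℝ => (r ^ 2 / 2 : ℝ) • D2 y w w) (r • D2 y w w) r := by
      have h := ((hasDerivAt_pow 2 r).div_const 2).smul_const (D2 y w w)
      refine h.congr_deriv ?_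
      norm_num
    refine ((h1.sub h2).sub h3).congr_deriv ?_
    simp only [hq_def, zero_smul, add_zero, sub_zero]
    ring
  have := norm_image_sub_le_of_norm_deriv_le_segment_01' (fun r _ => (hh r).hasDerivWithinAt)
    fun r hr => hqb r ⟨hr.1, hr.2.le⟩
  refine le_trans (le_of_eq ?_) this
  congr 1
  simp only [one_smul, zero_smul, add_zero, sub_zero, one_pow, ne_eq, OfNat.ofNat_ne_zero,
    not_false_eq_true, zero_pow, zero_div]
  ring

theorem exists_lipschitzWith_fderiv_fderiv {G : E → ℂ}
    (hG : ContDiff ℝ ((⊤ : ℕ∞) : WithTop ℕ∞) G) (hc : HasCompactSupport G) :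
    ∃ K, LipschitzWith K (fderiv ℝ (fderiv ℝ G)) := by
  have hG1 : ContDiff ℝ ((⊤ : ℕ∞) : WithTop ℕ∞) (fderiv ℝ G) := hG.fderiv_right (by simp)
  have hG2 : ContDiff ℝ ((⊤ : ℕ∞) : WithTop ℕ∞) (fderiv ℝ (fderiv ℝ G)) :=
    hG1.fderiv_right (by simp)
  exact hG2.lipschitzWith_of_hasCompactSupport ((hc.fderiv ℝ).fderiv ℝ) (by simp)

theorem hasFDerivAt_fderiv {G : E → ℂ} (hG : ContDiff ℝ ((⊤ : ℕ∞) : WithTop ℕ∞) G) (x : E) :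
    HasFDerivAt (fderiv ℝ G) (fderiv ℝ (fderiv ℝ G) x) x := by
  have hG1 : ContDiff ℝ ((⊤ : ℕ∞) : WithTop ℕ∞) (fderiv ℝ G) := hG.fderiv_right (by simp)
  exact ((hG1.differentiable (by simp)) x).hasFDerivAt

theorem exists_norm_taylor_two_le {G : E → ℂ} (hG : ContDiff ℝ ((⊤ : ℕ∞) : WithTop ℕ∞) G)
    (hc : HasCompactSupport G) :
    ∃ C : ℝ, 0 ≤ C ∧ ∀ y w : E, ‖G (y + w) - G y - fderiv ℝ G y w
      - (1 / 2 : ℝ) • fderiv ℝ (fderiv ℝ G) y w w‖ ≤ C * ‖w‖ ^ 3 := by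
  obtain ⟨K, hK⟩ := exists_lipschitzWith_fderiv_fderiv hG hc
  exact ⟨K, NNReal.coe_nonneg K, norm_taylor_two_le
    (fun x => ((hG.differentiable (by simp)) x).hasFDerivAt) (hasFDerivAt_fderiv hG) hK⟩

end Taylor

section Coord

variable {ι : Type*} [Fintype ι] [DecidableEq ι]

/-- The partial derivative in the coordinate `p`. -/
noncomputable def pd (p : ι) (F : (ι → ℝ) → ℂ) (x : ι → ℝ) : ℂ :=
  lineDeriv ℝ F x (Pi.single p 1)

theorem pd_eq_fderiv {F : (ι → ℝ) → ℂ} (hF : ContDiff ℝ ((⊤ : ℕ∞) : WithTop ℕ∞) F) (p : ι) :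
    pd p F = fun x => fderiv ℝ F x (Pi.single p 1) := by
  ext x
  exact ((hF.differentiable (by simp)) x).lineDeriv_eq_fderiv

theorem contDiff_pd {F : (ι → ℝ) → ℂ} (hF : ContDiff ℝ ((⊤ : ℕ∞) : WithTop ℕ∞) F) (p : ι) :
    ContDiff ℝ ((⊤ : ℕ∞) : WithTop ℕ∞) (pd p F) := by
  rw [pd_eq_fderiv hF]
  exact (hF.fderiv_right (by simp)).clm_apply contDiff_const

theorem hasCompactSupport_pd {F : (ι → ℝ) → ℂ} (hF : ContDiff ℝ ((⊤ : ℕ∞) : WithTop ℕ∞) F)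
    (hc : HasCompactSupport F) (p : ι) : HasCompactSupport (pd p F) := by
  rw [pd_eq_fderiv hF]
  exact hc.fderiv_apply ℝ (Pi.single p 1)

theorem pd_pd_eq_fderiv {F : (ι → ℝ) → ℂ} (hF : ContDiff ℝ ((⊤ : ℕ∞) : WithTop ℕ∞) F) (p : ι)
    (x : ι → ℝ) :
    pd p (pd p F) x = fderiv ℝ (fderiv ℝ F) x (Pi.single p 1) (Pi.single p 1) := by
  rw [pd_eq_fderiv (contDiff_pd hF p), pd_eq_fderiv hF]
  have h := hasFDerivAt_fderiv hF x
  have := (h.clm_apply (hasFDerivAt_const (Pi.single p (1 : ℝ)) x)).fderiv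
  simp only
  rw [this]
  simp

/-- The standard Gaussian measure on `ι → ℝ`. -/
noncomputable abbrev stdGauss (ι : Type*) [Fintype ι] : Measure (ι → ℝ) :=
  Measure.pi fun _ => gaussianReal 0 1

omit [DecidableEq ι] in
theorem memLp_eval_stdGauss (p : ι) {r : ℝ≥0∞} (hr : r ≠ ∞) :
    MemLp (fun g : ι → ℝ => g p) r (stdGauss ι) := by
  lift r to ℝ≥0 using hr
  exact (memLp_id_gaussianReal r).comp_measurePreserving (measurePreserving_eval _ p)

omit [DecidableEq ι] in
theorem integral_eval_stdGauss (p : ι) : ∫ g, g p ∂stdGauss ι = 0 := by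
  have := (measurePreserving_eval (fun _ : ι => gaussianReal 0 1) p).map_eq
  rw [← integral_id_gaussianReal (μ := 0) (v := 1), ← this,
    integral_map (measurable_pi_apply p).aemeasurable (by fun_prop)]

theorem integral_eval_mul_eval_stdGauss (p q : ι) :
    ∫ g, g p * g q ∂stdGauss ι = if p = q then 1 else 0 := by
  split_ifs with h
  · subst h
    have h1 := (measurePreserving_eval (fun _ : ι => gaussianReal 0 1) p).map_eq
    have h2 := variance_eq_integral (μ := gaussianReal 0 1) (X := id) (by fun_prop)
    rw [variance_id_gaussianReal] at h2
    simp only [id, integral_id_gaussianReal, sub_zero] at h2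
    rw [← h1, integral_map (measurable_pi_apply p).aemeasurable (by fun_prop)] at h2
    simpa [pow_two] using h2.symm
  · have hi : iIndepFun (fun (i : ι) (g : ι → ℝ) => g i) (stdGauss ι) :=
      iIndepFun_pi (X := fun _ => id) fun _ => aemeasurable_id
    rw [(hi.indepFun h).integral_fun_mul_eq_mul_integral
      (measurable_pi_apply p).aestronglyMeasurable (measurable_pi_apply q).aestronglyMeasurable,
      integral_eval_stdGauss, zero_mul]

omit [DecidableEq ι] in
theorem integrable_norm_pow_three_stdGauss : Integrable (fun g => ‖g‖ ^ 3) (stdGauss ι) := by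
  refine Integrable.mono' (g := fun g : ι → ℝ => ∑ p, ‖g p‖ ^ 3)
    (integrable_finsetSum _ fun p _ =>
      (memLp_eval_stdGauss p (r := (3 : ℕ)) (by simp)).integrable_norm_pow (by simp))
    (Continuous.aestronglyMeasurable (by fun_prop)) (.of_forall fun g => ?_)
  rw [Real.norm_of_nonneg (by positivity)]
  rcases isEmpty_or_nonempty ι with h | h
  · simp [Subsingleton.elim g 0]
  · obtain ⟨p, hp⟩ := Finite.exists_max fun p => ‖g p‖
    have hle : ‖g‖ ≤ ‖g p‖ := (pi_norm_le_iff_of_nonneg (norm_nonneg _)).2 hp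
    calc ‖g‖ ^ 3 ≤ ‖g p‖ ^ 3 := by gcongr
      _ ≤ _ := Finset.single_le_sum (f := fun p => ‖g p‖ ^ 3) (fun _ _ => by positivity)
        (Finset.mem_univ p)

/-- Centering removes the linear term, independence the mixed second-order ones, and unit variance
leaves the diagonal. Compact support makes the second derivative globally Lipschitz, so `C` is
uniform in `y` and the estimate can be integrated against any law. -/
theorem exists_gauss_taylor {G : (ι → ℝ) → ℂ} (hG : ContDiff ℝ ((⊤ : ℕ∞) : WithTop ℕ∞) G)
    (hc : HasCompactSupport G) :
    ∃ C : ℝ, 0 ≤ C ∧ ∀ (σ : ι → ℝ) (ρ : ℝ), (∀ p, |σ p| ≤ ρ) → 0 ≤ ρ → ∀ y,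
      ‖∫ g, G (fun p => y p + σ p * g p) ∂stdGauss ι - G y
        - (1 / 2 : ℝ) • ∑ p, (σ p ^ 2) • pd p (pd p G) y‖ ≤ C * ρ ^ 3 := by
  obtain ⟨C, hC, hT⟩ := exists_norm_taylor_two_le hG hc
  refine ⟨C * ∫ g, ‖g‖ ^ 3 ∂stdGauss ι, by positivity, fun σ ρ hσ hρ y => ?_⟩
  obtain ⟨K, hK⟩ := hc.exists_bound_of_continuous hG.continuous
  have hsum : ∀ g : ι → ℝ, (fun p => σ p * g p) =
      ∑ p, (σ p * g p) • (Pi.single p 1 : ι → ℝ) := fun g => by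
    ext q
    simp [Finset.sum_apply, Pi.single_apply]
  have hD1 : ∀ g : ι → ℝ, fderiv ℝ G y (fun p => σ p * g p) =
      ∑ p, g p • (σ p • fderiv ℝ G y (Pi.single p 1)) := fun g => by
    rw [hsum, map_sum]
    simp only [map_smul, smul_smul, mul_comm]
  have hD2 : ∀ g : ι → ℝ, fderiv ℝ (fderiv ℝ G) y (fun p => σ p * g p) (fun p => σ p * g p) =
      ∑ p, ∑ q, (g p * g q) •
        ((σ p * σ q) • fderiv ℝ (fderiv ℝ G) y (Pi.single p 1) (Pi.single q 1)) := fun g => by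
    rw [hsum, map_sum (fderiv ℝ (fderiv ℝ G) y), sum_apply]
    refine Finset.sum_congr rfl fun p _ => ?_
    rw [map_smul, smul_apply, map_sum, Finset.smul_sum]
    refine Finset.sum_congr rfl fun q _ => ?_
    rw [map_smul, smul_smul, smul_smul]
    congr 1
    ring
  have hi1 : ∀ p, Integrable (fun g : ι → ℝ => g p • (σ p • fderiv ℝ G y (Pi.single p 1)))
      (stdGauss ι) := fun p =>
    ((memLp_one_iff_integrable.1 (memLp_eval_stdGauss p (by simp)))).smul_const _
  have hi2 : ∀ p q, Integrable (fun g : ι → ℝ => (g p * g q) •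
      ((σ p * σ q) • fderiv ℝ (fderiv ℝ G) y (Pi.single p 1) (Pi.single q 1))) (stdGauss ι) :=
    fun p q => ((memLp_eval_stdGauss p (r := 2) (by simp)).integrable_mul
      (memLp_eval_stdGauss q (r := 2) (by simp))).smul_const _
  have hI1 : Integrable (fun g => fderiv ℝ G y (fun p => σ p * g p)) (stdGauss ι) := by
    simp_rw [hD1]; exact integrable_finsetSum _ fun p _ => hi1 p
  have hI2 : Integrable (fun g => fderiv ℝ (fderiv ℝ G) y (fun p => σ p * g p)
      (fun p => σ p * g p)) (stdGauss ι) := by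
    simp_rw [hD2]
    exact integrable_finsetSum _ fun p _ => integrable_finsetSum _ fun q _ => hi2 p q
  have hI0 : Integrable (fun g => G (fun p => y p + σ p * g p)) (stdGauss ι) :=
    Integrable.of_bound (C := K)
      (hG.continuous.comp (by fun_prop)).aestronglyMeasurable (.of_forall fun g => hK _)
  have hE1 : ∫ g, fderiv ℝ G y (fun p => σ p * g p) ∂stdGauss ι = 0 := by
    simp_rw [hD1]
    rw [integral_finsetSum _ fun p _ => hi1 p]
    simp_rw [integral_smul_const, integral_eval_stdGauss]
    simp
  have hE2 : ∫ g, fderiv ℝ (fderiv ℝ G) y (fun p => σ p * g p) (fun p => σ p * g p) ∂stdGauss ι =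
      ∑ p, (σ p ^ 2) • pd p (pd p G) y := by
    simp_rw [hD2]
    rw [integral_finsetSum _ fun p _ => integrable_finsetSum _ fun q _ => hi2 p q]
    refine Finset.sum_congr rfl fun p _ => ?_
    rw [integral_finsetSum _ fun q _ => hi2 p q]
    simp_rw [integral_smul_const, integral_eval_mul_eval_stdGauss]
    simp [pd_pd_eq_fderiv hG, pow_two]
  have hrw : ∫ g, G (fun p => y p + σ p * g p) ∂stdGauss ι - G y
        - (1 / 2 : ℝ) • ∑ p, (σ p ^ 2) • pd p (pd p G) y =
      ∫ g, (G (y + fun p => σ p * g p) - G y - fderiv ℝ G y (fun p => σ p * g p)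
        - (1 / 2 : ℝ) • fderiv ℝ (fderiv ℝ G) y (fun p => σ p * g p)
          (fun p => σ p * g p)) ∂stdGauss ι := by
    have hIa : Integrable (fun g => G (y + fun p => σ p * g p)) (stdGauss ι) := hI0
    have hIb : Integrable (fun g => G (y + fun p => σ p * g p) - G y) (stdGauss ι) :=
      hIa.sub (integrable_const _)
    have hIc : Integrable (fun g => G (y + fun p => σ p * g p) - G y
      - fderiv ℝ G y (fun p => σ p * g p)) (stdGauss ι) := hIb.sub hI1
    have hId : Integrable (fun g => (1 / 2 : ℝ) • fderiv ℝ (fderiv ℝ G) y (fun p => σ p * g p)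
      (fun p => σ p * g p)) (stdGauss ι) := hI2.smul (1 / 2 : ℝ)
    rw [integral_sub hIc hId, integral_sub hIb hI1, integral_sub hIa (integrable_const _),
      integral_smul, hE1, hE2, integral_const, probReal_univ, one_smul, sub_zero]
    rfl
  rw [hrw]
  have hb : ∀ g : ι → ℝ, ‖fun p => σ p * g p‖ ≤ ρ * ‖g‖ := fun g => by
    refine (pi_norm_le_iff_of_nonneg (by positivity)).2 fun p => ?_
    rw [norm_mul]
    exact mul_le_mul (hσ p) (norm_le_pi_norm g p) (norm_nonneg _) hρ
  refine (norm_integral_le_of_norm_le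
    (integrable_norm_pow_three_stdGauss.const_mul (C * ρ ^ 3)) (.of_forall fun g => ?_)).trans ?_
  · refine (hT _ _).trans ?_
    rw [mul_assoc, ← mul_pow]
    gcongr
    exact hb g
  · rw [integral_const_mul]
    exact le_of_eq (by ring)

/-! ### Short-time expansion and the forward equation. -/

/-- Derivative at time `0` of the flow `x ↦ exp (-a δ) x`, integrated against a test function. -/
theorem hasDerivAt_integral_decay (μ : Measure (ι → ℝ)) [IsProbabilityMeasure μ] (a : ι → ℝ)
    {G : (ι → ℝ) → ℂ} (hG : ContDiff ℝ ((⊤ : ℕ∞) : WithTop ℕ∞) G) (hc : HasCompactSupport G) :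
    HasDerivAt (fun δ : ℝ => ∫ x, G (fun p => Real.exp (-a p * δ) * x p) ∂μ)
      (-∑ p, a p • ∫ x, x p • pd p G x ∂μ) 0 := by
  obtain ⟨K, hK⟩ := hc.exists_bound_of_continuous hG.continuous
  -- The derivative of `G` along the linear drift. Compact support of `G` makes it bounded in spite
  -- of the growth of the drift, so a constant dominates and `μ` needs no moments.
  set m : (ι → ℝ) → ℂ := fun y => fderiv ℝ G y (fun p => -a p * y p) with hm
  have hmc : Continuous m :=
    (hG.continuous_fderiv (by simp)).clm_apply (by fun_prop)
  have hms : HasCompactSupport m :=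
    (hc.fderiv ℝ).mono' fun y hy => subset_tsupport _ fun h => hy (by simp [hm, h])
  obtain ⟨L, hL⟩ := hms.exists_bound_of_continuous hmc
  have hmsum : ∀ y, m y = -∑ p, a p • (y p • pd p G y) := fun y => by
    have : (fun p => -a p * y p) = ∑ p, (-(a p * y p)) • (Pi.single p 1 : ι → ℝ) := by
      ext q
      simp [Finset.sum_apply, Pi.single_apply]
    rw [hm]
    simp only
    rw [this, map_sum, ← Finset.sum_neg_distrib]
    refine Finset.sum_congr rfl fun p _ => ?_
    rw [map_smul, pd_eq_fderiv hG, smul_smul, neg_smul]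
  have key := hasDerivAt_integral_of_dominated_loc_of_deriv_le (μ := μ) (bound := fun _ => L)
    (F := fun (δ : ℝ) x => G (fun p => Real.exp (-a p * δ) * x p))
    (F' := fun (δ : ℝ) x => m (fun p => Real.exp (-a p * δ) * x p)) (x₀ := 0) (s := Set.univ)
    univ_mem (.of_forall fun δ => (hG.continuous.comp (by fun_prop)).aestronglyMeasurable)
    (Integrable.of_bound (C := K)
      (hG.continuous.comp (by fun_prop)).aestronglyMeasurable (.of_forall fun g => hK _))
    (hmc.comp (by fun_prop)).aestronglyMeasurable (.of_forall fun x δ _ => hL _)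
    (integrable_const _) (.of_forall fun x δ _ => ?_)
  · refine key.2.congr_deriv ?_
    simp only [mul_zero, Real.exp_zero, one_mul]
    simp_rw [hmsum]
    rw [integral_neg, integral_finsetSum]
    · simp_rw [integral_smul]
    · intro p _
      have hcc : HasCompactSupport fun x : ι → ℝ => x p • pd p G x :=
        (hasCompactSupport_pd hG hc p).mono fun x hx h => hx (by simp [h])
      have hcont : Continuous fun x : ι → ℝ => x p • pd p G x := by
        have := (contDiff_pd hG p).continuous
        fun_prop
      obtain ⟨M, hM⟩ := hcc.exists_bound_of_continuous hcont
      have hint : Integrable (fun x : ι → ℝ => x p • pd p G x) μ :=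
        Integrable.of_bound (C := M) hcont.aestronglyMeasurable (.of_forall hM)
      exact hint.smul (a p)
  · have h1 : HasDerivAt (fun (δ : ℝ) (p : ι) => Real.exp (-a p * δ) * x p)
        (fun p => -a p * (Real.exp (-a p * δ) * x p)) δ := by
      refine hasDerivAt_pi.2 fun p => ?_
      refine ((((hasDerivAt_id δ).const_mul (-a p)).exp).mul_const (x p)).congr_deriv ?_
      simp
      ring
    exact ((hG.differentiable (by simp) _).hasFDerivAt).comp_hasDerivAt δ h1

end Coord

section Coord

variable {ι : Type*} [Fintype ι] [DecidableEq ι]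

/-- The bound is of order `δ^{3/2}`, hence `o(δ)`. -/
theorem hasDerivWithinAt_zero_of_norm_le {r : ℝ → ℂ} {C L : ℝ}
    (h : ∀ δ, 0 ≤ δ → ‖r δ‖ ≤ C * √(L * δ) ^ 3) :
    HasDerivWithinAt r 0 (Set.Ici 0) 0 := by
  have h0 : r 0 = 0 := by simpa using h 0 le_rfl
  rw [hasDerivWithinAt_iff_tendsto_slope, Set.Ici_sdiff_left]
  have hlim : Tendsto (fun δ : ℝ => C * (|L| * √(L * δ))) (𝓝[>] 0) (𝓝 0) := by
    have : Continuous fun δ : ℝ => C * (|L| * √(L * δ)) := by fun_prop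
    have h2 := (this.tendsto 0).mono_left (nhdsWithin_le_nhds (s := Set.Ioi 0))
    simpa using h2
  refine squeeze_zero_norm' ?_ hlim
  filter_upwards [self_mem_nhdsWithin] with δ hδ
  have hδ' : (0 : ℝ) < δ := hδ
  rw [slope_def_module, h0, sub_zero, sub_zero, norm_smul, norm_inv, Real.norm_of_nonneg hδ'.le,
    inv_mul_le_iff₀ hδ']
  refine (h δ hδ'.le).trans (le_of_eq ?_)
  rcases le_or_gt 0 L with hL | hL
  · rw [pow_succ, Real.sq_sqrt (by positivity), abs_of_nonneg hL]
    ring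
  · rw [Real.sqrt_eq_zero_of_nonpos (by nlinarith)]
    simp

omit [DecidableEq ι] in
theorem integrable_of_hasCompactSupport {μ : Measure (ι → ℝ)} [IsFiniteMeasure μ]
    {G : (ι → ℝ) → ℂ} (hG : Continuous G) (hc : HasCompactSupport G) : Integrable G μ := by
  obtain ⟨K, hK⟩ := hc.exists_bound_of_continuous hG
  exact Integrable.of_bound (C := K) hG.aestronglyMeasurable (.of_forall hK)

theorem sq_ouStep_noise {a s t : ℝ} (ha : 0 ≤ a) (hs : 0 ≤ s) (ht : 0 ≤ t) :
    √(s * (1 - Real.exp (-(2 * a) * t))) ^ 2 = s * (1 - Real.exp (-(2 * a) * t)) := by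
  refine Real.sq_sqrt (mul_nonneg hs (sub_nonneg.2 (Real.exp_le_one_iff.2 ?_)))
  have : 0 ≤ a * t := by positivity
  linarith

/-- Given the starting point, the position at time `δ` is the decayed point plus independent
Gaussians of standard deviation `O(√δ)`, to which `exists_gauss_taylor` applies. The constant `L`
comes from `1 - e^{-2aδ} ≤ 2aδ`, with a sum in place of the maximum over coordinates. -/
theorem norm_integral_ouStep_sub_le (μ : Measure (ι → ℝ)) [IsProbabilityMeasure μ] {a s : ι → ℝ}
    (ha : ∀ p, 0 < a p) (hs : ∀ p, 0 ≤ s p)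
    {G : (ι → ℝ) → ℂ} (hG : ContDiff ℝ ((⊤ : ℕ∞) : WithTop ℕ∞) G) (hc : HasCompactSupport G) :
    ∃ C L : ℝ, ∀ δ, 0 ≤ δ →
      ‖∫ z, G (fun p => ouStep (a p) (s p) δ (z.1 p, z.2 p)) ∂(μ.prod (stdGauss ι))
        - ∫ x, G (fun p => Real.exp (-a p * δ) * x p) ∂μ
        - ∑ p, (1 / 2 * (s p * (1 - Real.exp (-(2 * a p) * δ)))) •
          ∫ x, pd p (pd p G) (fun p => Real.exp (-a p * δ) * x p) ∂μ‖ ≤ C * √(L * δ) ^ 3 := by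
  obtain ⟨C, hC, hT⟩ := exists_gauss_taylor hG hc
  obtain ⟨K, hK⟩ := hc.exists_bound_of_continuous hG.continuous
  refine ⟨C, ∑ p, 2 * a p * s p, fun δ hδ => ?_⟩
  set σ : ι → ℝ := fun p => √(s p * (1 - Real.exp (-(2 * a p) * δ))) with hσ_def
  have hσ : ∀ p, |σ p| ≤ √((∑ p, 2 * a p * s p) * δ) := fun p => by
    rw [abs_of_nonneg (Real.sqrt_nonneg _)]
    refine Real.sqrt_le_sqrt ?_
    have h1 := Real.add_one_le_exp (-(2 * a p) * δ)
    have h2 : 2 * a p * s p ≤ ∑ p, 2 * a p * s p :=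
      Finset.single_le_sum (f := fun p => 2 * a p * s p)
        (fun q _ => mul_nonneg (by have := ha q; positivity) (hs q)) (Finset.mem_univ p)
    have h3 := hs p
    calc s p * (1 - Real.exp (-(2 * a p) * δ)) ≤ s p * (2 * a p * δ) := by gcongr; linarith
      _ = 2 * a p * s p * δ := by ring
      _ ≤ _ := by gcongr
  have hcont : Continuous fun z : (ι → ℝ) × (ι → ℝ) =>
      G (fun p => ouStep (a p) (s p) δ (z.1 p, z.2 p)) := hG.continuous.comp (by fun_prop)
  have hi : Integrable (fun z : (ι → ℝ) × (ι → ℝ) =>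
      G (fun p => ouStep (a p) (s p) δ (z.1 p, z.2 p))) (μ.prod (stdGauss ι)) :=
    Integrable.of_bound (C := K) hcont.aestronglyMeasurable (.of_forall fun z => hK _)
  have hi1 : Integrable (fun x => ∫ g, G (fun p => ouStep (a p) (s p) δ (x p, g p)) ∂stdGauss ι)
      μ := hi.integral_prod_left
  have hcontD : Continuous fun x : ι → ℝ => fun p => Real.exp (-a p * δ) * x p := by fun_prop
  have hi2 : Integrable (fun x => G (fun p => Real.exp (-a p * δ) * x p)) μ :=
    Integrable.of_bound (C := K) (hG.continuous.comp hcontD).aestronglyMeasurable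
      (.of_forall fun z => hK _)
  have hi3 : ∀ p, Integrable (fun x => (1 / 2 * (s p * (1 - Real.exp (-(2 * a p) * δ)))) •
      pd p (pd p G) (fun p => Real.exp (-a p * δ) * x p)) μ := fun p => by
    have hGp := contDiff_pd (contDiff_pd hG p) p
    obtain ⟨M, hM⟩ := (hasCompactSupport_pd (contDiff_pd hG p)
      (hasCompactSupport_pd hG hc p) p).exists_bound_of_continuous hGp.continuous
    have : Integrable (fun x => pd p (pd p G) (fun p => Real.exp (-a p * δ) * x p)) μ :=
      Integrable.of_bound (C := M) (hGp.continuous.comp hcontD).aestronglyMeasurable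
        (.of_forall fun z => hM _)
    exact this.smul (1 / 2 * (s p * (1 - Real.exp (-(2 * a p) * δ))))
  have hrw : ∫ z, G (fun p => ouStep (a p) (s p) δ (z.1 p, z.2 p)) ∂(μ.prod (stdGauss ι))
        - ∫ x, G (fun p => Real.exp (-a p * δ) * x p) ∂μ
        - ∑ p, (1 / 2 * (s p * (1 - Real.exp (-(2 * a p) * δ)))) •
          ∫ x, pd p (pd p G) (fun p => Real.exp (-a p * δ) * x p) ∂μ =
      ∫ x, (∫ g, G (fun p => ouStep (a p) (s p) δ (x p, g p)) ∂stdGauss ι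
        - G (fun p => Real.exp (-a p * δ) * x p)
        - ∑ p, (1 / 2 * (s p * (1 - Real.exp (-(2 * a p) * δ)))) •
          pd p (pd p G) (fun p => Real.exp (-a p * δ) * x p)) ∂μ := by
    have hi12 : Integrable (fun x => ∫ g, G (fun p => ouStep (a p) (s p) δ (x p, g p)) ∂stdGauss ι
        - G (fun p => Real.exp (-a p * δ) * x p)) μ := hi1.sub hi2
    rw [integral_sub hi12 (integrable_finsetSum _ fun p _ => hi3 p),
      integral_sub hi1 hi2, integral_finsetSum _ fun p _ => hi3 p, integral_prod _ hi]
    simp_rw [integral_smul]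
  rw [hrw]
  refine (norm_integral_le_of_norm_le_const (C := C * √((∑ p, 2 * a p * s p) * δ) ^ 3)
    (.of_forall fun x => ?_)).trans (by simp)
  have := hT σ _ hσ (Real.sqrt_nonneg _) fun p => Real.exp (-a p * δ) * x p
  refine le_trans (le_of_eq ?_) this
  congr 2
  rw [Finset.smul_sum]
  refine Finset.sum_congr rfl fun p _ => ?_
  rw [smul_smul, hσ_def, sq_ouStep_noise (ha p).le (hs p) hδ]

theorem hasDerivWithinAt_integral_ouStep (μ : Measure (ι → ℝ)) [IsProbabilityMeasure μ]
    {a s : ι → ℝ} (ha : ∀ p, 0 < a p) (hs : ∀ p, 0 ≤ s p)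
    {G : (ι → ℝ) → ℂ} (hG : ContDiff ℝ ((⊤ : ℕ∞) : WithTop ℕ∞) G) (hc : HasCompactSupport G) :
    HasDerivWithinAt
      (fun δ => ∫ z, G (fun p => ouStep (a p) (s p) δ (z.1 p, z.2 p)) ∂(μ.prod (stdGauss ι)))
      (∑ p, a p • ∫ x, (s p • pd p (pd p G) x - x p • pd p G x) ∂μ) (Set.Ici 0) 0 := by
  obtain ⟨C, L, h⟩ := norm_integral_ouStep_sub_le μ ha hs hG hc
  have h1 := hasDerivWithinAt_zero_of_norm_le h
  have h2 := (hasDerivAt_integral_decay μ a hG hc).hasDerivWithinAt (s := Set.Ici 0)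
  -- The coefficient vanishes at `δ = 0`, so the product rule leaves only its derivative `a p * s
  -- p`.
  have h3 : ∀ p, HasDerivAt (fun δ => (1 / 2 * (s p * (1 - Real.exp (-(2 * a p) * δ)))) •
      ∫ x, pd p (pd p G) (fun p => Real.exp (-a p * δ) * x p) ∂μ)
      ((a p * s p) • ∫ x, pd p (pd p G) x ∂μ) 0 := fun p => by
    have hu : HasDerivAt (fun δ : ℝ => 1 / 2 * (s p * (1 - Real.exp (-(2 * a p) * δ))))
        (a p * s p) 0 := by
      refine ((((((hasDerivAt_id (0 : ℝ)).const_mul (-(2 * a p))).exp).const_sub 1).const_mul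
        (s p)).const_mul (1 / 2)).congr_deriv ?_
      simp
      ring
    refine (hu.smul (hasDerivAt_integral_decay μ a (contDiff_pd (contDiff_pd hG p) p)
      (hasCompactSupport_pd (contDiff_pd hG p) (hasCompactSupport_pd hG hc p) p))).congr_deriv ?_
    simp
  have h4 := (HasDerivAt.fun_sum fun p (_ : p ∈ Finset.univ) => h3 p).hasDerivWithinAt
    (s := Set.Ici 0)
  refine (((h1.add h4).add h2).congr_deriv ?_).congr (fun δ _ => ?_) ?_
  · rw [zero_add, ← sub_eq_add_neg, ← Finset.sum_sub_distrib]
    refine Finset.sum_congr rfl fun p _ => ?_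
    have hd := contDiff_pd hG p
    have hdc := hasCompactSupport_pd hG hc p
    have i1 : Integrable (fun x => s p • pd p (pd p G) x) μ :=
      (integrable_of_hasCompactSupport (contDiff_pd hd p).continuous
        (hasCompactSupport_pd hd hdc p)).smul (s p)
    have i2 : Integrable (fun x : ι → ℝ => x p • pd p G x) μ := by
      refine integrable_of_hasCompactSupport ?_ (hdc.mono fun x hx h => hx (by simp [h]))
      have := hd.continuous
      fun_prop
    rw [integral_sub i1 i2, integral_smul, smul_sub, smul_smul]
  · simp
  · simp

variable (ν : ι → Measure ℝ) [∀ p, IsProbabilityMeasure (ν p)]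

omit [DecidableEq ι] in
theorem integral_pi_ouLaw {a s : ι → ℝ} {G : (ι → ℝ) → ℂ} (hG : Continuous G) (t : ℝ) :
    ∫ x, G x ∂(Measure.pi fun p => ouLaw (a p) (s p) t (ν p)) =
      ∫ z, G (fun p => ouStep (a p) (s p) t (z.1 p, z.2 p))
        ∂((Measure.pi ν).prod (stdGauss ι)) := by
  have : Continuous fun (z : (ι → ℝ) × (ι → ℝ)) p => ouStep (a p) (s p) t (z.1 p, z.2 p) := by
    fun_prop
  rw [← map_prod_pi_ouStep, integral_map this.measurable.aemeasurable hG.aestronglyMeasurable]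

omit [DecidableEq ι] in
theorem continuous_integral_pi_ouLaw {a s : ι → ℝ} {G : (ι → ℝ) → ℂ} (hG : Continuous G)
    (hc : HasCompactSupport G) :
    Continuous fun t => ∫ x, G x ∂(Measure.pi fun p => ouLaw (a p) (s p) t (ν p)) := by
  obtain ⟨K, hK⟩ := hc.exists_bound_of_continuous hG
  simp_rw [integral_pi_ouLaw ν hG]
  refine continuous_of_dominated (bound := fun _ => K) (fun t => ?_)
    (fun t => .of_forall fun z => hK _) (integrable_const _) (.of_forall fun z => ?_)
  · exact (hG.comp (by fun_prop)).aestronglyMeasurable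
  · refine hG.comp (continuous_pi fun p => ?_)
    unfold ouStep
    fun_prop

/-- Kolmogorov's forward equation for the Ornstein–Uhlenbeck flow of product measures. -/
theorem hasDerivWithinAt_integral_pi_ouLaw {a s : ι → ℝ} (ha : ∀ p, 0 < a p) (hs : ∀ p, 0 ≤ s p)
    {G : (ι → ℝ) → ℂ} (hG : ContDiff ℝ ((⊤ : ℕ∞) : WithTop ℕ∞) G) (hc : HasCompactSupport G)
    {t : ℝ} (ht : 0 ≤ t) :
    HasDerivWithinAt (fun t => ∫ x, G x ∂(Measure.pi fun p => ouLaw (a p) (s p) t (ν p)))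
      (∑ p, a p • ∫ x, (s p • pd p (pd p G) x - x p • pd p G x)
        ∂(Measure.pi fun p => ouLaw (a p) (s p) t (ν p))) (Set.Ici t) t := by
  -- By the semigroup property the right derivative at `t` is the one at `0` for the flow restarted
  -- from the law at time `t`.
  have h := hasDerivWithinAt_integral_ouStep (Measure.pi fun p => ouLaw (a p) (s p) t (ν p))
    ha hs hG hc
  rw [← sub_self t] at h
  have hd : HasDerivWithinAt (fun u => u - t) 1 (Set.Ici t) t :=
    ((hasDerivAt_id t).sub_const t).hasDerivWithinAt
  have h2 := HasDerivWithinAt.scomp (h := fun u => u - t) t h hd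
    fun u (hu : t ≤ u) => by simpa using hu
  rw [one_smul] at h2
  have key : ∀ u, t ≤ u → ∫ x, G x ∂(Measure.pi fun p => ouLaw (a p) (s p) u (ν p)) =
      ∫ z, G (fun p => ouStep (a p) (s p) (u - t) (z.1 p, z.2 p))
        ∂((Measure.pi fun p => ouLaw (a p) (s p) t (ν p)).prod (stdGauss ι)) := fun u hu => by
    rw [← integral_pi_ouLaw (fun p => ouLaw (a p) (s p) t (ν p)) hG.continuous]
    congr 2
    ext1 p
    rw [ouLaw_add (ha p).le (hs p) ht (sub_nonneg.2 hu), add_sub_cancel]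
  exact h2.congr (fun u hu => key u hu) (key t le_rfl)

end Coord

/-! ### Moments along the flow. -/

theorem memLp_two_ouLaw {a s t : ℝ} {ν : Measure ℝ} [IsProbabilityMeasure ν]
    (h2 : MemLp id 2 ν) : MemLp id 2 (ouLaw a s t ν) := by
  rw [ouLaw, memLp_map_measure_iff (by fun_prop) (by fun_prop)]
  have h3 : MemLp id 2 (gaussianReal 0 1) := memLp_id_gaussianReal 2
  exact ((h2.comp_measurePreserving measurePreserving_fst).const_mul _).add
    ((h3.comp_measurePreserving measurePreserving_snd).const_mul _)

theorem integral_id_ouLaw {a s t : ℝ} {ν : Measure ℝ} [IsProbabilityMeasure ν]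
    (h2 : MemLp id 2 ν) (h0 : ∫ x, x ∂ν = 0) : ∫ x, x ∂(ouLaw a s t ν) = 0 := by
  have h1 : Integrable (fun x => x) ν := h2.integrable (by simp)
  have h3 : Integrable (fun x => x) (gaussianReal 0 1) :=
    (memLp_id_gaussianReal 1).integrable (by simp)
  rw [ouLaw, integral_map (by fun_prop) (by fun_prop)]
  unfold ouStep
  rw [integral_add ((h1.comp_fst _).const_mul _) ((h3.comp_snd _).const_mul _),
    integral_const_mul, integral_const_mul, integral_fun_fst (fun x => x),
    integral_fun_snd (fun x => x)]
  simp [h0, integral_id_gaussianReal]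

/-- Since `e^{-2at} s + (1 - e^{-2at}) s = s`, a variance equal to the stationary one is preserved;
the cancellation in the generator is thus available at every time. -/
theorem integral_sq_ouLaw {a s t : ℝ} (ha : 0 ≤ a) (hs : 0 ≤ s) (ht : 0 ≤ t) {ν : Measure ℝ}
    [IsProbabilityMeasure ν] (h2 : MemLp id 2 ν) (h0 : ∫ x, x ∂ν = 0)
    (hvar : ∫ x, x ^ 2 ∂ν = s) : ∫ x, x ^ 2 ∂(ouLaw a s t ν) = s := by
  have h1 : Integrable (fun x => x) ν := h2.integrable (by simp)
  have h1' : Integrable (fun x => x ^ 2) ν := h2.integrable_sq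
  have h3 : Integrable (fun x => x) (gaussianReal 0 1) :=
    (memLp_id_gaussianReal 1).integrable (by simp)
  have h3' : Integrable (fun x => x ^ 2) (gaussianReal 0 1) :=
    (memLp_id_gaussianReal 2).integrable_sq
  have hg : ∫ x, x ^ 2 ∂(gaussianReal 0 1) = 1 := by
    have h2 := variance_eq_integral (μ := gaussianReal 0 1) (X := id) (by fun_prop)
    rw [variance_id_gaussianReal] at h2
    simpa [integral_id_gaussianReal] using h2.symm
  rw [ouLaw, integral_map (by fun_prop) (by fun_prop)]
  unfold ouStep
  set α := Real.exp (-a * t) with hα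
  set β := √(s * (1 - Real.exp (-(2 * a) * t))) with hβ
  have hexp : ∀ z : ℝ × ℝ, (α * z.1 + β * z.2) ^ 2 =
      α ^ 2 * z.1 ^ 2 + (2 * α * β) * (z.1 * z.2) + β ^ 2 * z.2 ^ 2 := fun z => by ring
  simp_rw [hexp]
  have i1 := (h1'.comp_fst (gaussianReal 0 1)).const_mul (α ^ 2)
  have i2 := (h1.mul_prod h3).const_mul (2 * α * β)
  have i3 := (h3'.comp_snd ν).const_mul (β ^ 2)
  have i12 : Integrable (fun x : ℝ × ℝ => α ^ 2 * x.1 ^ 2 + 2 * α * β * (x.1 * x.2))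
    (ν.prod (gaussianReal 0 1)) := i1.add i2
  rw [integral_add i12 i3, integral_add i1 i2, integral_const_mul, integral_const_mul,
    integral_const_mul, integral_fun_fst (fun x => x ^ 2), integral_fun_snd (fun x => x ^ 2),
    integral_prod_mul (fun x => x) (fun x => x), h0, hvar, hg, hβ, sq_ouStep_noise ha hs ht, hα,
    ← Real.exp_nat_mul, show ((2 : ℕ) : ℝ) * (-a * t) = -(2 * a) * t by push_cast; ring]
  simp
  ring

/-! ### Cancellation in the generator, one coordinate at a time. -/

section Coord

variable {ι : Type*} [Fintype ι] [DecidableEq ι]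

/-- The supremum of `|∂_p^k F|` over the segment joining `x` to its projection on `x p = 0`. -/
noncomputable def supPd (p : ι) (k : ℕ) (F : (ι → ℝ) → ℂ) (x : ι → ℝ) : ℝ≥0∞ :=
  ⨆ θ ∈ Set.Icc (0 : ℝ) 1, ‖((pd p)^[k] F) (Function.update x p (θ * x p))‖ₑ

/-- The contribution of the coordinate `p` to `Xi`, for the truncation level `κ` and the
variance `s`. -/
noncomputable def xiTerm (κ s : ℝ) (p : ι) (μ : Measure (ι → ℝ)) (F : (ι → ℝ) → ℂ) : ℝ≥0∞ :=
  ENNReal.ofReal s⁻¹ * (∫⁻ x in {x | κ ≤ |x p|}, ‖x p‖ₑ * supPd p 1 F x ∂μ)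
  + ENNReal.ofReal s⁻¹ * (∫⁻ x in {x | κ ≤ |x p|}, ‖x p‖ₑ ^ 2 * supPd p 2 F x ∂μ)
  + (∫⁻ x in {x | κ ≤ |x p|}, supPd p 2 F x ∂μ)
  + ENNReal.ofReal s⁻¹ * (∫⁻ x in {x | |x p| < κ}, ‖x p‖ₑ ^ 3 * supPd p 3 F x ∂μ)
  + (∫⁻ x in {x | |x p| < κ}, ‖x p‖ₑ * supPd p 3 F x ∂μ)

variable {F : (ι → ℝ) → ℂ}

theorem contDiff_pd_iterate (hF : ContDiff ℝ ((⊤ : ℕ∞) : WithTop ℕ∞) F) (p : ι) (k : ℕ) :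
    ContDiff ℝ ((⊤ : ℕ∞) : WithTop ℕ∞) ((pd p)^[k] F) := by
  induction k with
  | zero => exact hF
  | succ k ih => rw [Function.iterate_succ_apply']; exact contDiff_pd ih p

theorem measurable_supPd (hF : ContDiff ℝ ((⊤ : ℕ∞) : WithTop ℕ∞) F) (p : ι) (k : ℕ) :
    Measurable (supPd p k F) := by
  refine LowerSemicontinuous.measurable (lowerSemicontinuous_biSup fun θ _ => ?_)
  have := (contDiff_pd_iterate hF p k).continuous
  refine Continuous.lowerSemicontinuous (Continuous.enorm (this.comp ?_))
  exact continuous_id.update p (by fun_prop)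

omit [Fintype ι] in
theorem enorm_le_supPd (p : ι) (k : ℕ) (x : ι → ℝ) {θ : ℝ} (hθ : θ ∈ Set.Icc (0 : ℝ) 1) :
    ‖((pd p)^[k] F) (Function.update x p (θ * x p))‖ₑ ≤ supPd p k F x :=
  le_iSup₂ (f := fun θ (_ : θ ∈ Set.Icc (0 : ℝ) 1) =>
    ‖((pd p)^[k] F) (Function.update x p (θ * x p))‖ₑ) θ hθ

omit [Fintype ι] in
theorem enorm_self_le_supPd (p : ι) (k : ℕ) (x : ι → ℝ) :
    ‖((pd p)^[k] F) x‖ₑ ≤ supPd p k F x := by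
  simpa using enorm_le_supPd (F := F) p k x (θ := 1) (by simp)

omit [Fintype ι] in
theorem enorm_update_zero_le_supPd (p : ι) (k : ℕ) (x : ι → ℝ) :
    ‖((pd p)^[k] F) (Function.update x p 0)‖ₑ ≤ supPd p k F x := by
  simpa using enorm_le_supPd (F := F) p k x (θ := 0) (by simp)

theorem supPd_ne_top (hF : ContDiff ℝ ((⊤ : ℕ∞) : WithTop ℕ∞) F) (p : ι) (k : ℕ) (x : ι → ℝ) :
    supPd p k F x ≠ ∞ := by
  have hc : Continuous fun θ : ℝ => ((pd p)^[k] F) (Function.update x p (θ * x p)) :=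
    (contDiff_pd_iterate hF p k).continuous.comp (continuous_const.update p (by fun_prop))
  obtain ⟨M, hM⟩ := (isCompact_Icc (a := (0 : ℝ)) (b := 1)).exists_bound_of_continuousOn
    hc.continuousOn
  refine ne_top_of_le_ne_top (ENNReal.ofReal_ne_top (r := M)) (iSup₂_le fun θ hθ => ?_)
  rw [← ofReal_norm]
  exact ENNReal.ofReal_le_ofReal (hM θ hθ)

theorem norm_le_toReal_supPd (hF : ContDiff ℝ ((⊤ : ℕ∞) : WithTop ℕ∞) F) (p : ι) (k : ℕ)
    (x : ι → ℝ) {θ : ℝ} (hθ : θ ∈ Set.Icc (0 : ℝ) 1) :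
    ‖((pd p)^[k] F) (Function.update x p (θ * x p))‖ ≤ (supPd p k F x).toReal := by
  have := ENNReal.toReal_mono (supPd_ne_top hF p k x) (enorm_le_supPd (F := F) p k x hθ)
  rwa [toReal_enorm] at this

theorem hasDerivAt_update (hF : ContDiff ℝ ((⊤ : ℕ∞) : WithTop ℕ∞) F) (p : ι) (x : ι → ℝ)
    (θ : ℝ) : HasDerivAt (fun θ : ℝ => F (Function.update x p (θ * x p)))
      (x p • pd p F (Function.update x p (θ * x p))) θ := by
  have h1 : HasDerivAt (fun θ : ℝ => Function.update x p (θ * x p))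
      (x p • (Pi.single p 1 : ι → ℝ)) θ := by
    refine hasDerivAt_pi.2 fun q => ?_
    by_cases hq : q = p
    · subst hq
      simpa using (hasDerivAt_id θ).mul_const (x q)
    · simpa [Function.update_of_ne hq, Pi.single_eq_of_ne hq] using hasDerivAt_const θ (x q)
  have h2 := ((hF.differentiable (by simp)) (Function.update x p (θ * x p))).hasFDerivAt
  refine (h2.comp_hasDerivAt θ h1).congr_deriv ?_
  rw [map_smul, pd_eq_fderiv hF]

theorem norm_update_sub_le (hF : ContDiff ℝ ((⊤ : ℕ∞) : WithTop ℕ∞) F) (p : ι) (x : ι → ℝ)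
    {θ : ℝ} (hθ : θ ∈ Set.Icc (0 : ℝ) 1) :
    ‖F (Function.update x p (θ * x p)) - F (Function.update x p 0)‖ ≤
      |x p| * (supPd p 1 F x).toReal := by
  have := norm_image_sub_le_of_norm_deriv_le_segment' (C := |x p| * (supPd p 1 F x).toReal)
    (fun θ _ => (hasDerivAt_update hF p x θ).hasDerivWithinAt) (fun u hu => ?_) θ hθ
  · simp only [zero_mul, sub_zero] at this
    refine this.trans (mul_le_of_le_one_right (by positivity) hθ.2)
  · rw [norm_smul]
    exact mul_le_mul_of_nonneg_left (norm_le_toReal_supPd hF p 1 x ⟨hu.1, hu.2.le⟩)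
      (norm_nonneg _)

theorem norm_taylor_update_le (hF : ContDiff ℝ ((⊤ : ℕ∞) : WithTop ℕ∞) F) (p : ι) (x : ι → ℝ) :
    ‖F x - F (Function.update x p 0) - x p • pd p F (Function.update x p 0)‖ ≤
      |x p| ^ 2 * (supPd p 2 F x).toReal := by
  have hd : ∀ θ : ℝ, HasDerivAt (fun θ : ℝ => F (Function.update x p (θ * x p))
      - θ • (x p • pd p F (Function.update x p 0)))
      (x p • (pd p F (Function.update x p (θ * x p)) - pd p F (Function.update x p 0))) θ :=
    fun θ => by
      have h := (hasDerivAt_update hF p x θ).sub ((hasDerivAt_id θ).smul_const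
        (x p • pd p F (Function.update x p 0)))
      refine h.congr_deriv ?_
      rw [one_smul, smul_sub]
  have := norm_image_sub_le_of_norm_deriv_le_segment_01'
    (C := |x p| ^ 2 * (supPd p 2 F x).toReal) (fun θ _ => (hd θ).hasDerivWithinAt) fun u hu => ?_
  · simpa [sub_right_comm] using this
  · rw [norm_smul, pow_two, mul_assoc]
    refine mul_le_mul_of_nonneg_left ?_ (norm_nonneg _)
    exact norm_update_sub_le (contDiff_pd hF p) p x ⟨hu.1, hu.2.le⟩

variable {ν : ι → Measure ℝ} [∀ p, IsProbabilityMeasure (ν p)]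

/-- The second factor depends only on the coordinates other than `p`, hence is independent of `x p`.
-/
theorem integral_mul_update_zero (p : ι) {f : ℝ → ℝ} (hf : Measurable f)
    {K : (ι → ℝ) → ℂ} (hK : Measurable K) :
    ∫ x, f (x p) • K (Function.update x p 0) ∂Measure.pi ν =
      (∫ r, f r ∂ν p) • ∫ x, K (Function.update x p 0) ∂Measure.pi ν := by
  have hi : iIndepFun (fun (i : ι) (x : ι → ℝ) => x i) (Measure.pi ν) :=
    iIndepFun_pi (X := fun _ => id) fun _ => aemeasurable_id
  have h1 := hi.indepFun_finset {p} {p}ᶜ disjoint_compl_right measurable_pi_apply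
  set e : (({p}ᶜ : Finset ι) → ℝ) → ι → ℝ :=
    fun r q => if h : q ∈ ({p}ᶜ : Finset ι) then r ⟨q, h⟩ else 0 with he
  have hem : Measurable e := measurable_pi_lambda _ fun q => by
    by_cases h : q ∈ ({p}ᶜ : Finset ι)
    · simp only [he, h, dite_true]; fun_prop
    · simp only [he, h, dite_false]; fun_prop
  have hφ : Measurable fun r : ({p} : Finset ι) → ℝ => ((f (r ⟨p, by simp⟩) : ℝ) : ℂ) := by
    fun_prop
  have h2 := h1.comp hφ (hK.comp hem)
  have heq : ∀ x : ι → ℝ, e (fun i => x i) = Function.update x p 0 := fun x => by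
    ext q
    by_cases h : q = p
    · subst h; simp [he]
    · simp [he, h]
  have hup : Measurable fun x : ι → ℝ => Function.update x p 0 :=
    (continuous_id.update p continuous_const).measurable
  have h3 := h2.integral_fun_mul_eq_mul_integral
    (hφ.comp (by fun_prop)).aestronglyMeasurable
    ((hK.comp hem).comp (by fun_prop)).aestronglyMeasurable
  simp only [Function.comp_apply, heq] at h3
  simp_rw [Complex.real_smul]
  rw [h3, integral_complex_ofReal]
  congr 2
  have := (measurePreserving_eval ν p).map_eq
  rw [← this, integral_map (measurable_pi_apply p).aemeasurable hf.aestronglyMeasurable]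

end Coord

section Coord

variable {ι : Type*} [Fintype ι] [DecidableEq ι]

theorem norm_smul_le_of_mem_Icc {c : ℝ} (hc : c ∈ Set.Icc (0 : ℝ) 1) (z : ℂ) :
    ‖c • z‖ ≤ ‖z‖ := by
  rw [norm_smul, Real.norm_of_nonneg hc.1]
  exact mul_le_of_le_one_left (norm_nonneg _) hc.2

theorem enorm_smul_le_of_mem_Icc {c : ℝ} (hc : c ∈ Set.Icc (0 : ℝ) 1) (z : ℂ) :
    ‖c • z‖ₑ ≤ ‖z‖ₑ :=
  enorm_le_iff_norm_le.2 (norm_smul_le_of_mem_Icc hc z)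

-- Used for large `x p`. No expansion is made: every derivative is evaluated at an end of the
-- segment (`θ = 1` or `θ = 0`), and the triangle inequality is enough.
omit [Fintype ι] in
theorem enorm_main_integrand_large {F : (ι → ℝ) → ℂ} {χ : (ι → ℝ) → ℝ}
    (h01 : ∀ x, χ x ∈ Set.Icc (0 : ℝ) 1) {s : ℝ} (hs : 0 ≤ s) (p : ι) (x : ι → ℝ) :
    ‖χ x • (s • pd p (pd p F) x - x p • pd p F x)
      - (s • (χ (Function.update x p 0) • pd p (pd p F) (Function.update x p 0))
        - x p • (χ (Function.update x p 0) • pd p F (Function.update x p 0))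
        - x p ^ 2 • (χ (Function.update x p 0) • pd p (pd p F) (Function.update x p 0)))‖ₑ ≤
    ENNReal.ofReal (2 * s) * supPd p 2 F x + 2 * (‖x p‖ₑ * supPd p 1 F x)
      + ‖x p‖ₑ ^ 2 * supPd p 2 F x := by
  set y := Function.update x p 0 with hy
  have e : χ x • (s • pd p (pd p F) x - x p • pd p F x)
      - (s • (χ y • pd p (pd p F) y) - x p • (χ y • pd p F y)
        - x p ^ 2 • (χ y • pd p (pd p F) y)) =
      (s • (χ x • pd p (pd p F) x - χ y • pd p (pd p F) y)
        - x p • (χ x • pd p F x - χ y • pd p F y)) + x p ^ 2 • (χ y • pd p (pd p F) y) := by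
    simp only [Complex.real_smul]
    push_cast
    ring
  have b1 : ‖χ x • pd p F x‖ₑ ≤ supPd p 1 F x :=
    (enorm_smul_le_of_mem_Icc (h01 x) _).trans (enorm_self_le_supPd p 1 x)
  have b2 : ‖χ y • pd p F y‖ₑ ≤ supPd p 1 F x :=
    (enorm_smul_le_of_mem_Icc (h01 y) _).trans (enorm_update_zero_le_supPd p 1 x)
  have b3 : ‖χ x • pd p (pd p F) x‖ₑ ≤ supPd p 2 F x :=
    (enorm_smul_le_of_mem_Icc (h01 x) _).trans (enorm_self_le_supPd p 2 x)
  have b4 : ‖χ y • pd p (pd p F) y‖ₑ ≤ supPd p 2 F x :=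
    (enorm_smul_le_of_mem_Icc (h01 y) _).trans (enorm_update_zero_le_supPd p 2 x)
  rw [e]
  refine (enorm_add_le _ _).trans (add_le_add (enorm_sub_le.trans (add_le_add ?_ ?_)) ?_)
  · rw [enorm_smul, Real.enorm_of_nonneg hs, mul_comm 2 s, ENNReal.ofReal_mul hs, mul_assoc]
    refine mul_le_mul_right (enorm_sub_le.trans ((add_le_add b3 b4).trans (le_of_eq ?_))) _
    rw [ENNReal.ofReal_ofNat, two_mul]
  · rw [enorm_smul, mul_left_comm]
    refine mul_le_mul_right (enorm_sub_le.trans ((add_le_add b1 b2).trans (le_of_eq ?_))) _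
    rw [two_mul]
  · rw [enorm_smul, enorm_pow]
    exact mul_le_mul_right b4 _

/-- Equality of the cutoff at both points lets it factor out. What is left is a zeroth-order Taylor
remainder of `∂_p² F` and a first-order one of `∂_p F`, both governed by the third derivative. -/
theorem enorm_main_integrand_small {F : (ι → ℝ) → ℂ}
    (hF : ContDiff ℝ ((⊤ : ℕ∞) : WithTop ℕ∞) F) {χ : (ι → ℝ) → ℝ}
    (h01 : ∀ x, χ x ∈ Set.Icc (0 : ℝ) 1) {s : ℝ} (hs : 0 ≤ s) (p : ι) (x : ι → ℝ)
    (hx : χ x = χ (Function.update x p 0)) :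
    ‖χ x • (s • pd p (pd p F) x - x p • pd p F x)
      - (s • (χ (Function.update x p 0) • pd p (pd p F) (Function.update x p 0))
        - x p • (χ (Function.update x p 0) • pd p F (Function.update x p 0))
        - x p ^ 2 • (χ (Function.update x p 0) • pd p (pd p F) (Function.update x p 0)))‖ₑ ≤
    ENNReal.ofReal s * (‖x p‖ₑ * supPd p 3 F x) + ‖x p‖ₑ ^ 3 * supPd p 3 F x := by
  have hF1 := contDiff_pd hF p
  have hF2 := contDiff_pd hF1 p
  rw [← hx]
  set y := Function.update x p 0 with hy
  have e : χ x • (s • pd p (pd p F) x - x p • pd p F x)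
      - (s • (χ x • pd p (pd p F) y) - x p • (χ x • pd p F y)
        - x p ^ 2 • (χ x • pd p (pd p F) y)) =
      χ x • (s • (pd p (pd p F) x - pd p (pd p F) y)
        - x p • (pd p F x - pd p F y - x p • pd p (pd p F) y)) := by
    simp only [Complex.real_smul]
    push_cast
    ring
  rw [e]
  refine (enorm_smul_le_of_mem_Icc (h01 x) _).trans (enorm_sub_le.trans (add_le_add ?_ ?_))
  · rw [enorm_smul, Real.enorm_of_nonneg hs]
    refine mul_le_mul_right ?_ _
    have := norm_update_sub_le hF2 p x (θ := 1) (by simp)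
    rw [one_mul, Function.update_eq_self] at this
    rw [← ofReal_norm, Real.enorm_eq_ofReal_abs]
    refine (ENNReal.ofReal_le_ofReal this).trans ?_
    rw [ENNReal.ofReal_mul (abs_nonneg _)]
    exact mul_le_mul_right ENNReal.ofReal_toReal_le _
  · have := norm_taylor_update_le hF1 p x
    rw [enorm_smul, pow_succ', mul_assoc]
    refine mul_le_mul_right ?_ _
    rw [← ofReal_norm, Real.enorm_eq_ofReal_abs]
    refine (ENNReal.ofReal_le_ofReal this).trans ?_
    rw [ENNReal.ofReal_mul (by positivity), ENNReal.ofReal_pow (abs_nonneg _)]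
    exact mul_le_mul_right ENNReal.ofReal_toReal_le _

omit [Fintype ι] [DecidableEq ι] in
theorem measurableSet_le_abs_eval (κ : ℝ) (p : ι) : MeasurableSet {x : ι → ℝ | κ ≤ |x p|} :=
  measurableSet_le measurable_const (by fun_prop)

variable {ν : ι → Measure ℝ} [∀ p, IsProbabilityMeasure (ν p)]

/-- The generator of the Ornstein–Uhlenbeck flow in the coordinate `p`, with a cutoff: if the
coordinate is centered with variance `s` and independent of the others, the terms of order at most
two at `x p = 0` cancel. -/
theorem enorm_integral_generator_le {F : (ι → ℝ) → ℂ}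
    (hF : ContDiff ℝ ((⊤ : ℕ∞) : WithTop ℕ∞) F) {χ : (ι → ℝ) → ℝ} (hχ : Continuous χ)
    (hc : HasCompactSupport χ) (h01 : ∀ x, χ x ∈ Set.Icc (0 : ℝ) 1) {p : ι}
    (hχp : ∀ x, |x p| ≤ 1 → χ x = χ (Function.update x p 0)) {κ s : ℝ} (hκ : κ ≤ 1) (hs : 0 < s)
    (h2 : MemLp id 2 (ν p)) (h0 : ∫ r, r ∂ν p = 0) (hv : ∫ r, r ^ 2 ∂ν p = s) :
    ‖∫ x, χ x • (s • pd p (pd p F) x - x p • pd p F x) ∂Measure.pi ν‖ₑ ≤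
      ENNReal.ofReal (2 * s) * xiTerm κ s p (Measure.pi ν) F := by
  have hF1 := (contDiff_pd hF p).continuous
  have hF2 := (contDiff_pd (contDiff_pd hF p) p).continuous
  have hup : Continuous fun x : ι → ℝ => Function.update x p 0 :=
    continuous_id.update p continuous_const
  have hK1c : Continuous fun x => χ x • pd p F x := by fun_prop
  have hK2c : Continuous fun x => χ x • pd p (pd p F) x := by fun_prop
  obtain ⟨M1, hM1⟩ := (hc.mono fun x hx h => hx (by simp [h]) :
    HasCompactSupport fun x => χ x • pd p F x).exists_bound_of_continuous hK1c
  obtain ⟨M2, hM2⟩ := (hc.mono fun x hx h => hx (by simp [h]) :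
    HasCompactSupport fun x => χ x • pd p (pd p F) x).exists_bound_of_continuous hK2c
  have hxp2 : MemLp (fun x : ι → ℝ => x p) 2 (Measure.pi ν) :=
    h2.comp_measurePreserving (measurePreserving_eval ν p)
  have hQ : Integrable (fun x => χ x • (s • pd p (pd p F) x - x p • pd p F x))
      (Measure.pi ν) :=
    integrable_of_hasCompactSupport (by fun_prop) (hc.mono fun x hx h => hx (by simp [h]))
  have i0 : Integrable (fun x => χ (Function.update x p 0) •
      pd p (pd p F) (Function.update x p 0)) (Measure.pi ν) :=
    Integrable.of_bound (C := M2) (hK2c.comp hup).aestronglyMeasurable (.of_forall fun x => hM2 _)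
  have i1 : Integrable (fun x => x p • (χ (Function.update x p 0) •
      pd p F (Function.update x p 0))) (Measure.pi ν) := by
    refine ((hxp2.integrable (by simp)).norm.mul_const M1).mono'
      (Continuous.aestronglyMeasurable (by fun_prop)) (.of_forall fun x => ?_)
    rw [norm_smul]
    exact mul_le_mul_of_nonneg_left (hM1 _) (norm_nonneg _)
  have i2 : Integrable (fun x => x p ^ 2 • (χ (Function.update x p 0) •
      pd p (pd p F) (Function.update x p 0))) (Measure.pi ν) := by
    refine (hxp2.integrable_sq.norm.mul_const M2).mono'
      (Continuous.aestronglyMeasurable (by fun_prop)) (.of_forall fun x => ?_)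
    rw [norm_smul]
    exact mul_le_mul_of_nonneg_left (hM2 _) (norm_nonneg _)
  have i0' : Integrable (fun x => s • (χ (Function.update x p 0) •
      pd p (pd p F) (Function.update x p 0))) (Measure.pi ν) := i0.smul s
  have i01 : Integrable (fun x => s • (χ (Function.update x p 0) •
      pd p (pd p F) (Function.update x p 0)) - x p • (χ (Function.update x p 0) •
      pd p F (Function.update x p 0))) (Measure.pi ν) := i0'.sub i1
  have i012 : Integrable (fun x => s • (χ (Function.update x p 0) •
      pd p (pd p F) (Function.update x p 0)) - x p • (χ (Function.update x p 0) •
      pd p F (Function.update x p 0)) - x p ^ 2 • (χ (Function.update x p 0) •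
      pd p (pd p F) (Function.update x p 0))) (Measure.pi ν) := i01.sub i2
  have e1 := integral_mul_update_zero (ν := ν) p measurable_id hK1c.measurable
  have e2 := integral_mul_update_zero (ν := ν) p (f := fun r => r ^ 2) (by fun_prop)
    hK2c.measurable
  simp only [id, h0, zero_smul] at e1
  rw [hv] at e2
  -- A quadratic in `x p` with independent coefficients. Its mean is `s A - 0 - s A`, where `A` is
  -- the mean of the cut off second derivative at the projection, so it can be subtracted for free.
  have hzero : ∫ x, (s • (χ (Function.update x p 0) •
      pd p (pd p F) (Function.update x p 0)) - x p • (χ (Function.update x p 0) •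
      pd p F (Function.update x p 0)) - x p ^ 2 • (χ (Function.update x p 0) •
      pd p (pd p F) (Function.update x p 0))) ∂Measure.pi ν = 0 := by
    rw [integral_sub i01 i2, integral_sub i0' i1, e1, e2, integral_smul]
    simp
  rw [← sub_zero (∫ x, χ x • (s • pd p (pd p F) x - x p • pd p F x) ∂Measure.pi ν), ← hzero,
    ← integral_sub hQ i012]
  refine (enorm_integral_le_lintegral_enorm _).trans ?_
  have hbig := measurableSet_le_abs_eval κ p
  have hsmall : {x : ι → ℝ | κ ≤ |x p|}ᶜ = {x | |x p| < κ} := by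
    ext x; simp
  have hsm : MeasurableSet {x : ι → ℝ | |x p| < κ} := by rw [← hsmall]; exact hbig.compl
  have m1 := measurable_supPd hF p 1
  have m2 := measurable_supPd hF p 2
  have m3 := measurable_supPd hF p 3
  have mx : Measurable fun x : ι → ℝ => ‖x p‖ₑ := by fun_prop
  have n1 : Measurable fun x => ‖x p‖ₑ * supPd p 1 F x := by fun_prop
  have n2 : Measurable fun x => ‖x p‖ₑ ^ 2 * supPd p 2 F x := by fun_prop
  have n3 : Measurable fun x => ‖x p‖ₑ * supPd p 3 F x := by fun_prop
  have n4 : Measurable fun x => ‖x p‖ₑ ^ 3 * supPd p 3 F x := by fun_prop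
  have n5 : Measurable fun x => 2 * (‖x p‖ₑ * supPd p 1 F x) := by fun_prop
  rw [← lintegral_add_compl _ hbig, hsmall]
  refine (add_le_add (setLIntegral_mono' hbig fun x _ => enorm_main_integrand_large h01 hs.le p x)
    (setLIntegral_mono' hsm fun x hx =>
      enorm_main_integrand_small hF h01 hs.le p x
        (hχp x ((show |x p| < κ from hx).le.trans hκ)))).trans ?_
  rw [lintegral_add_right _ n2, lintegral_add_right _ n5, lintegral_const_mul _ m2,
    lintegral_const_mul _ n1, lintegral_add_right _ n4, lintegral_const_mul _ n3, xiTerm]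
  have hinv : ENNReal.ofReal (2 * s) * ENNReal.ofReal s⁻¹ = 2 := by
    rw [← ENNReal.ofReal_mul (by positivity), mul_assoc, mul_inv_cancel₀ hs.ne', mul_one,
      ENNReal.ofReal_ofNat]
  have h2s : ENNReal.ofReal s ≤ ENNReal.ofReal (2 * s) := ENNReal.ofReal_le_ofReal (by linarith)
  simp only [mul_add, ← mul_assoc, hinv]
  set I1 := ∫⁻ x in {x | κ ≤ |x p|}, ‖x p‖ₑ * supPd p 1 F x ∂Measure.pi ν
  set I2 := ∫⁻ x in {x | κ ≤ |x p|}, ‖x p‖ₑ ^ 2 * supPd p 2 F x ∂Measure.pi ν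
  set I3 := ∫⁻ x in {x | κ ≤ |x p|}, supPd p 2 F x ∂Measure.pi ν
  set I4 := ∫⁻ x in {x | |x p| < κ}, ‖x p‖ₑ ^ 3 * supPd p 3 F x ∂Measure.pi ν
  set I5 := ∫⁻ x in {x | |x p| < κ}, ‖x p‖ₑ * supPd p 3 F x ∂Measure.pi ν
  -- The factor `2` is required by `I1` and `I3`; the other terms are enlarged to match.
  calc ENNReal.ofReal (2 * s) * I3 + 2 * I1 + I2 + (ENNReal.ofReal s * I5 + I4)
      ≤ ENNReal.ofReal (2 * s) * I3 + 2 * I1 + 2 * I2 + (ENNReal.ofReal (2 * s) * I5 + 2 * I4) := by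
        gcongr
        · exact le_mul_of_one_le_left zero_le one_le_two
        · exact le_mul_of_one_le_left zero_le one_le_two
    _ = _ := by ring

end Coord

/-! ### Cutoffs and the error they cause in the generator. -/

/-- A smooth bump function on the line, equal to `1` on `[-1, 1]` and to `0` off `[-2, 2]`. -/
noncomputable def bump : ContDiffBump (0 : ℝ) := ⟨1, 2, one_pos, one_lt_two⟩

/-- The rescaled bump function, equal to `1` on `[-R, R]` and to `0` off `[-2R, 2R]`. -/
noncomputable def cutoff (R r : ℝ) : ℝ := bump (r / R)

theorem contDiff_deriv {f : ℝ → ℝ} (hf : ContDiff ℝ ((⊤ : ℕ∞) : WithTop ℕ∞) f) :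
    ContDiff ℝ ((⊤ : ℕ∞) : WithTop ℕ∞) (deriv f) :=
  (contDiff_infty_iff_deriv.1 hf).2

theorem contDiff_bump : ContDiff ℝ ((⊤ : ℕ∞) : WithTop ℕ∞) bump := bump.contDiff

theorem contDiff_cutoff (R : ℝ) : ContDiff ℝ ((⊤ : ℕ∞) : WithTop ℕ∞) (cutoff R) :=
  contDiff_bump.comp (contDiff_id.div_const R)

theorem cutoff_mem_Icc (R r : ℝ) : cutoff R r ∈ Set.Icc (0 : ℝ) 1 :=
  ⟨bump.nonneg, bump.le_one⟩

theorem cutoff_eq_one {R r : ℝ} (hR : 0 < R) (hr : |r| ≤ R) : cutoff R r = 1 := by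
  refine bump.one_of_mem_closedBall ?_
  rw [mem_closedBall_zero_iff, Real.norm_eq_abs, abs_div, abs_of_pos hR, div_le_iff₀ hR]
  simpa [bump] using hr

theorem cutoff_eq_zero {R r : ℝ} (hR : 0 < R) (hr : 2 * R ≤ |r|) : cutoff R r = 0 := by
  refine bump.zero_of_le_dist ?_
  rw [dist_zero_right, Real.norm_eq_abs, abs_div, abs_of_pos hR, le_div_iff₀ hR]
  simpa [bump] using hr

theorem deriv_cutoff (R : ℝ) : deriv (cutoff R) = fun r => deriv bump (r / R) / R := by
  ext r
  have h : HasDerivAt bump (deriv bump (r / R)) (r / R) :=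
    ((contDiff_bump.differentiable (by simp)) (r / R)).hasDerivAt
  have h2 := h.comp r ((hasDerivAt_id r).div_const R)
  rw [mul_one_div] at h2
  exact h2.deriv

theorem deriv_deriv_cutoff (R : ℝ) :
    deriv (deriv (cutoff R)) = fun r => deriv (deriv bump) (r / R) / R / R := by
  ext r
  have hb : ContDiff ℝ ((⊤ : ℕ∞) : WithTop ℕ∞) (deriv bump) :=
    contDiff_deriv contDiff_bump
  have h : HasDerivAt (deriv bump) (deriv (deriv bump) (r / R)) (r / R) :=
    ((hb.differentiable (by simp)) (r / R)).hasDerivAt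
  have h2 := (h.comp r ((hasDerivAt_id r).div_const R)).div_const R
  rw [mul_one_div] at h2
  rw [deriv_cutoff]
  exact h2.deriv

theorem deriv_cutoff_eq_zero {R r : ℝ} (hR : 0 < R) (hr : |r| < R) :
    deriv (cutoff R) r = 0 := by
  have h : cutoff R =ᶠ[𝓝 r] fun _ => 1 := by
    filter_upwards [(isOpen_lt continuous_abs continuous_const).mem_nhds hr] with u hu
    exact cutoff_eq_one hR (le_of_lt hu)
  rw [h.deriv_eq, deriv_const]

theorem deriv_deriv_cutoff_eq_zero {R r : ℝ} (hR : 0 < R) (hr : |r| < R) :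
    deriv (deriv (cutoff R)) r = 0 := by
  have h : deriv (cutoff R) =ᶠ[𝓝 r] fun _ => 0 := by
    filter_upwards [(isOpen_lt continuous_abs continuous_const).mem_nhds hr] with u hu
    exact deriv_cutoff_eq_zero hR hu
  rw [h.deriv_eq, deriv_const]

theorem deriv_cutoff_eq_zero_of_lt {R r : ℝ} (hR : 0 < R) (hr : 2 * R < |r|) :
    deriv (cutoff R) r = 0 := by
  have h : cutoff R =ᶠ[𝓝 r] fun _ => 0 := by
    filter_upwards [(isOpen_lt continuous_const continuous_abs).mem_nhds hr] with u hu
    exact cutoff_eq_zero hR (le_of_lt hu)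
  rw [h.deriv_eq, deriv_const]

/-- The constant serves every `R ≥ 1`. The product with `|r|` comes from the drift `x_p ∂_p`; it
stays bounded because the derivative is at most `C1 / R` and vanishes beyond `2 * R`. -/
theorem exists_cutoff_deriv_bound : ∃ C : ℝ, 0 ≤ C ∧ ∀ R : ℝ, 1 ≤ R → ∀ r,
    |deriv (cutoff R) r| ≤ C ∧ |r| * |deriv (cutoff R) r| ≤ C ∧
      |deriv (deriv (cutoff R)) r| ≤ C := by
  have hb : ContDiff ℝ ((⊤ : ℕ∞) : WithTop ℕ∞) (deriv bump) :=
    contDiff_deriv contDiff_bump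
  have hb2 : ContDiff ℝ ((⊤ : ℕ∞) : WithTop ℕ∞) (deriv (deriv bump)) :=
    contDiff_deriv hb
  have hc : HasCompactSupport (deriv bump) := bump.hasCompactSupport.deriv
  obtain ⟨C1, h1⟩ := hc.exists_bound_of_continuous hb.continuous
  obtain ⟨C2, h2⟩ := hc.deriv.exists_bound_of_continuous hb2.continuous
  have hC1 : 0 ≤ C1 := (norm_nonneg _).trans (h1 0)
  have hC2 : 0 ≤ C2 := (norm_nonneg _).trans (h2 0)
  refine ⟨2 * C1 + C2, by positivity, fun R hR r => ?_⟩
  have hR0 : 0 < R := by linarith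
  have hd1 : |deriv (cutoff R) r| ≤ C1 / R := by
    rw [deriv_cutoff]
    simp only
    rw [abs_div, abs_of_pos hR0]
    gcongr
    exact h1 _
  have hC1R : C1 / R ≤ C1 := div_le_self hC1 hR
  refine ⟨by linarith, ?_, ?_⟩
  · by_cases hr : 2 * R < |r|
    · rw [deriv_cutoff_eq_zero_of_lt hR0 hr]
      simp
      positivity
    · calc |r| * |deriv (cutoff R) r| ≤ (2 * R) * (C1 / R) := by
            gcongr
            exact not_lt.1 hr
        _ = 2 * C1 := by field_simp
        _ ≤ _ := by linarith
  · rw [deriv_deriv_cutoff]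
    simp only
    rw [abs_div, abs_div, abs_of_pos hR0]
    calc |deriv (deriv bump) (r / R)| / R / R ≤ |deriv (deriv bump) (r / R)| :=
          (div_le_self (by positivity) hR).trans (div_le_self (by positivity) hR)
      _ ≤ C2 := h2 _
      _ ≤ _ := by linarith

section Coord

variable {ι : Type*} [Fintype ι] [DecidableEq ι]

/-- The cutoff to the box of side `2R`. -/
noncomputable def boxCutoff (R : ℝ) (x : ι → ℝ) : ℝ := ∏ q, cutoff R (x q)

omit [DecidableEq ι] in
theorem contDiff_boxCutoff (R : ℝ) :
    ContDiff ℝ ((⊤ : ℕ∞) : WithTop ℕ∞) (boxCutoff R : (ι → ℝ) → ℝ) :=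
  contDiff_prod fun q _ => (contDiff_cutoff R).comp (contDiff_apply ℝ ℝ q)

omit [DecidableEq ι] in
theorem boxCutoff_mem_Icc (R : ℝ) (x : ι → ℝ) : boxCutoff R x ∈ Set.Icc (0 : ℝ) 1 :=
  ⟨Finset.prod_nonneg fun _ _ => (cutoff_mem_Icc R _).1,
    Finset.prod_le_one (fun _ _ => (cutoff_mem_Icc R _).1) fun _ _ => (cutoff_mem_Icc R _).2⟩

omit [DecidableEq ι] in
theorem boxCutoff_eq_one {R : ℝ} (hR : 0 < R) {x : ι → ℝ} (hx : ‖x‖ ≤ R) : boxCutoff R x = 1 :=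
  Finset.prod_eq_one fun q _ => cutoff_eq_one hR ((norm_le_pi_norm x q).trans hx)

omit [DecidableEq ι] in
theorem hasCompactSupport_boxCutoff {R : ℝ} (hR : 0 < R) :
    HasCompactSupport (boxCutoff R : (ι → ℝ) → ℝ) := by
  refine HasCompactSupport.intro (isCompact_closedBall (0 : ι → ℝ) (2 * R)) fun x hx => ?_
  rw [mem_closedBall_zero_iff, pi_norm_le_iff_of_nonneg (by positivity)] at hx
  push Not at hx
  obtain ⟨q, hq⟩ := hx
  exact Finset.prod_eq_zero (Finset.mem_univ q) (cutoff_eq_zero hR hq.le)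

/-- The product of the cutoffs in the coordinates other than `p`. -/
noncomputable def restCutoff (R : ℝ) (p : ι) (x : ι → ℝ) : ℝ :=
  ∏ q ∈ Finset.univ.erase p, cutoff R (x q)

theorem boxCutoff_eq (R : ℝ) (p : ι) (x : ι → ℝ) :
    boxCutoff R x = cutoff R (x p) * restCutoff R p x :=
  (Finset.mul_prod_erase _ _ (Finset.mem_univ p)).symm

theorem restCutoff_mem_Icc (R : ℝ) (p : ι) (x : ι → ℝ) : restCutoff R p x ∈ Set.Icc (0 : ℝ) 1 :=
  ⟨Finset.prod_nonneg fun _ _ => (cutoff_mem_Icc R _).1,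
    Finset.prod_le_one (fun _ _ => (cutoff_mem_Icc R _).1) fun _ _ => (cutoff_mem_Icc R _).2⟩

theorem restCutoff_congr (R : ℝ) (p : ι) {x y : ι → ℝ} (h : ∀ q, q ≠ p → x q = y q) :
    restCutoff R p x = restCutoff R p y :=
  Finset.prod_congr rfl fun q hq => by rw [h q (Finset.ne_of_mem_erase hq)]

theorem boxCutoff_update_zero {R : ℝ} (hR : 1 ≤ R) {p : ι} {x : ι → ℝ} (hx : |x p| ≤ 1) :
    boxCutoff R x = boxCutoff R (Function.update x p 0) := by
  rw [boxCutoff_eq R p, boxCutoff_eq R p, cutoff_eq_one (by linarith) (hx.trans hR),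
    Function.update_self, cutoff_eq_one (by linarith) (by simp; linarith)]
  congr 1
  exact restCutoff_congr R p fun q hq => (Function.update_of_ne hq _ _).symm

/-- A general `f` allows two uses: `cutoff R` for the first derivative, and `deriv (cutoff R)` when
differentiating again. -/
theorem hasLineDerivAt_cutoff_smul {f f' : ℝ → ℝ} (hf : ∀ r, HasDerivAt f (f' r) r)
    {F : (ι → ℝ) → ℂ} (hF : ContDiff ℝ ((⊤ : ℕ∞) : WithTop ℕ∞) F) (R : ℝ) (p : ι) (x : ι → ℝ) :
    HasLineDerivAt ℝ (fun x => (f (x p) * restCutoff R p x) • F x)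
      ((f' (x p) * restCutoff R p x) • F x + (f (x p) * restCutoff R p x) • pd p F x) x
      (Pi.single p 1) := by
  have h1 : HasDerivAt (fun τ : ℝ => f (x p + τ)) (f' (x p)) 0 := by
    have := hf (x p + 0)
    rw [add_zero] at this
    exact HasDerivAt.comp_const_add (x p) 0 (by rwa [add_zero])
  have h2 : HasDerivAt (fun τ : ℝ => F (x + τ • Pi.single p 1)) (pd p F x) 0 :=
    ((hF.differentiable (by simp)) x).lineDifferentiableAt.hasLineDerivAt
  have h3 := (h1.mul_const (restCutoff R p x)).smul h2
  have e : (fun τ : ℝ => (f ((x + τ • (Pi.single p 1 : ι → ℝ)) p) *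
      restCutoff R p (x + τ • (Pi.single p 1 : ι → ℝ))) • F (x + τ • Pi.single p 1)) =
      fun τ : ℝ => (f (x p + τ) * restCutoff R p x) • F (x + τ • Pi.single p 1) := by
    ext1 τ
    rw [restCutoff_congr R p (y := x) fun q hq => by simp [hq]]
    simp
  unfold HasLineDerivAt
  rw [e]
  refine h3.congr_deriv ?_
  simp only [add_zero, zero_smul]
  ring

variable {F : (ι → ℝ) → ℂ}

theorem hasDerivAt_cutoff (R r : ℝ) : HasDerivAt (cutoff R) (deriv (cutoff R) r) r :=
  (((contDiff_cutoff R).differentiable (by simp)) r).hasDerivAt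

theorem hasDerivAt_deriv_cutoff (R r : ℝ) :
    HasDerivAt (deriv (cutoff R)) (deriv (deriv (cutoff R)) r) r := by
  have hb : ContDiff ℝ ((⊤ : ℕ∞) : WithTop ℕ∞) (deriv (cutoff R)) :=
    contDiff_deriv (contDiff_cutoff R)
  exact ((hb.differentiable (by simp)) r).hasDerivAt

theorem pd_boxCutoff_smul (hF : ContDiff ℝ ((⊤ : ℕ∞) : WithTop ℕ∞) F) (R : ℝ) (p : ι) :
    pd p (fun x => boxCutoff R x • F x) = fun x =>
      (deriv (cutoff R) (x p) * restCutoff R p x) • F x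
        + (cutoff R (x p) * restCutoff R p x) • pd p F x := by
  ext x
  simp_rw [boxCutoff_eq R p]
  exact (hasLineDerivAt_cutoff_smul (hasDerivAt_cutoff R) hF R p x).lineDeriv

theorem pd_pd_boxCutoff_smul (hF : ContDiff ℝ ((⊤ : ℕ∞) : WithTop ℕ∞) F) (R : ℝ) (p : ι)
    (x : ι → ℝ) :
    pd p (pd p (fun x => boxCutoff R x • F x)) x =
      (deriv (deriv (cutoff R)) (x p) * restCutoff R p x) • F x
        + (2 * (deriv (cutoff R) (x p) * restCutoff R p x)) • pd p F x
        + (cutoff R (x p) * restCutoff R p x) • pd p (pd p F) x := by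
  rw [pd_boxCutoff_smul hF]
  have h : HasLineDerivAt ℝ (fun x => (deriv (cutoff R) (x p) * restCutoff R p x) • F x
      + (cutoff R (x p) * restCutoff R p x) • pd p F x) _ x (Pi.single p 1) :=
    HasDerivAt.add (hasLineDerivAt_cutoff_smul (hasDerivAt_deriv_cutoff R) hF R p x)
      (hasLineDerivAt_cutoff_smul (hasDerivAt_cutoff R) (contDiff_pd hF p) R p x)
  refine h.lineDeriv.trans ?_
  rw [two_mul, add_smul]
  ring

/-- The terms in which the generator falls on the cutoff are supported on `R ≤ |x p|`. -/
theorem enorm_generator_boxCutoff_sub_le {C : ℝ} (hC0 : 0 ≤ C)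
    (hC : ∀ R : ℝ, 1 ≤ R → ∀ r, |deriv (cutoff R) r| ≤ C ∧ |r| * |deriv (cutoff R) r| ≤ C ∧
      |deriv (deriv (cutoff R)) r| ≤ C)
    (hF : ContDiff ℝ ((⊤ : ℕ∞) : WithTop ℕ∞) F) {R s : ℝ} (hR : 1 ≤ R) (hs : 0 ≤ s) (p : ι)
    (x : ι → ℝ) :
    ‖(s • pd p (pd p (fun x => boxCutoff R x • F x)) x
        - x p • pd p (fun x => boxCutoff R x • F x) x)
      - boxCutoff R x • (s • pd p (pd p F) x - x p • pd p F x)‖ₑ ≤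
    {x : ι → ℝ | R ≤ |x p|}.indicator (fun x => ENNReal.ofReal (C * (s + 1)) * ‖F x‖ₑ
      + ENNReal.ofReal (2 * s * C / R) * (‖x p‖ₑ * supPd p 1 F x)) x := by
  have hR0 : 0 < R := by linarith
  rw [pd_pd_boxCutoff_smul hF, pd_boxCutoff_smul hF, boxCutoff_eq R p]
  simp only
  set η := restCutoff R p x with hη
  have e : (s • ((deriv (deriv (cutoff R)) (x p) * η) • F x
        + (2 * (deriv (cutoff R) (x p) * η)) • pd p F x
        + (cutoff R (x p) * η) • pd p (pd p F) x)
        - x p • ((deriv (cutoff R) (x p) * η) • F x + (cutoff R (x p) * η) • pd p F x))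
      - (cutoff R (x p) * η) • (s • pd p (pd p F) x - x p • pd p F x) =
      η • ((s * deriv (deriv (cutoff R)) (x p) - x p * deriv (cutoff R) (x p)) • F x
        + (2 * s * deriv (cutoff R) (x p)) • pd p F x) := by
    simp only [Complex.real_smul]
    push_cast
    ring
  rw [e]
  by_cases hx : R ≤ |x p|
  · rw [Set.indicator_of_mem (show x ∈ {x : ι → ℝ | R ≤ |x p|} from hx)]
    obtain ⟨c1, c2, c3⟩ := hC R hR (x p)
    refine (enorm_smul_le_of_mem_Icc (restCutoff_mem_Icc R p x) _).trans
      ((enorm_add_le _ _).trans (add_le_add ?_ ?_))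
    · rw [enorm_smul, Real.enorm_eq_ofReal_abs]
      gcongr
      refine (abs_sub _ _).trans ?_
      rw [abs_mul, abs_mul, abs_of_nonneg hs]
      nlinarith
    · have h1 : ‖pd p F x‖ₑ ≤ supPd p 1 F x := enorm_self_le_supPd p 1 x
      have h2 : ENNReal.ofReal R ≤ ‖x p‖ₑ := by
        rw [Real.enorm_eq_ofReal_abs]
        exact ENNReal.ofReal_le_ofReal hx
      -- As `R ≤ |x p|` here, trading `R` for `|x p|` yields both the decay `1 / R` and the weight
      -- that occurs in the first term of `xiTerm`.
      have h3 : 2 * s * C = (2 * s * C / R) * R := by field_simp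
      rw [enorm_smul, Real.enorm_eq_ofReal_abs]
      calc ENNReal.ofReal |2 * s * deriv (cutoff R) (x p)| * ‖pd p F x‖ₑ
          ≤ ENNReal.ofReal (2 * s * C) * supPd p 1 F x := by
            gcongr
            rw [abs_mul, abs_of_nonneg (by positivity)]
            gcongr
        _ = ENNReal.ofReal (2 * s * C / R) * (ENNReal.ofReal R * supPd p 1 F x) := by
            rw [← mul_assoc, ← ENNReal.ofReal_mul (by positivity), ← h3]
        _ ≤ _ := by gcongr
  · rw [Set.indicator_of_notMem (show x ∉ {x : ι → ℝ | R ≤ |x p|} from hx)]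
    rw [deriv_cutoff_eq_zero hR0 (not_le.1 hx), deriv_deriv_cutoff_eq_zero hR0 (not_le.1 hx)]
    simp

end Coord

/-! ### Removing the cutoff. -/

section Coord

variable {ι : Type*} [Fintype ι] [DecidableEq ι] {ν : ι → Measure ℝ}
  [∀ p, IsProbabilityMeasure (ν p)] {F : (ι → ℝ) → ℂ}

omit [DecidableEq ι] in
theorem contDiff_boxCutoff_smul (hF : ContDiff ℝ ((⊤ : ℕ∞) : WithTop ℕ∞) F) (R : ℝ) :
    ContDiff ℝ ((⊤ : ℕ∞) : WithTop ℕ∞) fun x => boxCutoff R x • F x :=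
  (contDiff_boxCutoff R).smul hF

omit [DecidableEq ι] in
theorem hasCompactSupport_boxCutoff_smul {R : ℝ} (hR : 0 < R) :
    HasCompactSupport fun x => boxCutoff R x • F x :=
  (hasCompactSupport_boxCutoff hR).mono fun x hx h => hx (by simp [h])

/-- The generator of the truncated function is the truncated generator, where the cancellation takes
place, plus a commutator. The part of the commutator with `∂_p F` is absorbed by the first term of
`xiTerm`, so finiteness of `xiTerm` stands in for integrability of the derivative. -/
theorem enorm_integral_generator_boxCutoff_le {C : ℝ} (hC0 : 0 ≤ C)
    (hC : ∀ R : ℝ, 1 ≤ R → ∀ r, |deriv (cutoff R) r| ≤ C ∧ |r| * |deriv (cutoff R) r| ≤ C ∧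
      |deriv (deriv (cutoff R)) r| ≤ C)
    (hF : ContDiff ℝ ((⊤ : ℕ∞) : WithTop ℕ∞) F) {R : ℝ} (hR : 1 ≤ R) {p : ι} {κ s : ℝ}
    (hκ : κ ≤ 1) (hs : 0 < s) (h2 : MemLp id 2 (ν p)) (h0 : ∫ r, r ∂ν p = 0)
    (hv : ∫ r, r ^ 2 ∂ν p = s) :
    ‖∫ x, (s • pd p (pd p fun x => boxCutoff R x • F x) x
        - x p • pd p (fun x => boxCutoff R x • F x) x) ∂Measure.pi ν‖ₑ ≤
      ENNReal.ofReal (2 * s) * xiTerm κ s p (Measure.pi ν) F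
      + (ENNReal.ofReal (C * (s + 1)) * (∫⁻ x in {x | R ≤ |x p|}, ‖F x‖ₑ ∂Measure.pi ν)
        + ENNReal.ofReal (2 * s * C / R) *
          (ENNReal.ofReal s * xiTerm κ s p (Measure.pi ν) F)) := by
  have hR0 : 0 < R := by linarith
  have hcs := hasCompactSupport_boxCutoff (ι := ι) hR0
  have hG := contDiff_boxCutoff_smul hF R
  have hGc : HasCompactSupport fun x => boxCutoff R x • F x := hasCompactSupport_boxCutoff_smul hR0
  have hG1 := contDiff_pd hG p
  have hG1c := hasCompactSupport_pd hG hGc p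
  have hG2 := (contDiff_pd hG1 p).continuous
  have hG2c := hasCompactSupport_pd hG1 hG1c p
  have hF1 := contDiff_pd hF p
  have hF2 := (contDiff_pd hF1 p).continuous
  have hb := (contDiff_boxCutoff (ι := ι) R).continuous
  have i1 : Integrable (fun x => s • pd p (pd p fun x => boxCutoff R x • F x) x
      - x p • pd p (fun x => boxCutoff R x • F x) x) (Measure.pi ν) := by
    refine ((integrable_of_hasCompactSupport hG2 hG2c).smul s).sub
      (integrable_of_hasCompactSupport ?_ (hG1c.mono fun x hx h => hx (by simp only [h, smul_zero])))
    have := hG1.continuous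
    fun_prop
  have i2 : Integrable (fun x => boxCutoff R x • (s • pd p (pd p F) x - x p • pd p F x))
      (Measure.pi ν) := by
    refine integrable_of_hasCompactSupport ?_ (hcs.mono fun x hx h => hx (by simp [h]))
    have := hF1.continuous
    fun_prop
  rw [← add_sub_cancel (∫ x, boxCutoff R x • (s • pd p (pd p F) x - x p • pd p F x) ∂Measure.pi ν)
    (∫ x, (s • pd p (pd p fun x => boxCutoff R x • F x) x
        - x p • pd p (fun x => boxCutoff R x • F x) x) ∂Measure.pi ν), ← integral_sub i1 i2]
  refine (enorm_add_le _ _).trans (add_le_add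
    (enorm_integral_generator_le hF hb hcs (boxCutoff_mem_Icc R)
      (fun x hx => boxCutoff_update_zero hR hx) hκ hs h2 h0 hv) ?_)
  refine (enorm_integral_le_lintegral_enorm _).trans ((lintegral_mono fun x =>
    enorm_generator_boxCutoff_sub_le hC0 hC hF hR hs.le p x).trans ?_)
  have m1 := measurable_supPd hF p 1
  have mF := hF.continuous.measurable
  have n1 : Measurable fun x : ι → ℝ => ‖x p‖ₑ * supPd p 1 F x := by fun_prop
  have n2 : Measurable fun x : ι → ℝ => ENNReal.ofReal (2 * s * C / R) *
    (‖x p‖ₑ * supPd p 1 F x) := by fun_prop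
  rw [lintegral_indicator (measurableSet_le_abs_eval R p), lintegral_add_right _ n2,
    lintegral_const_mul _ (by fun_prop), lintegral_const_mul _ n1]
  gcongr
  have hsub : ∫⁻ x in {x | R ≤ |x p|}, ‖x p‖ₑ * supPd p 1 F x ∂Measure.pi ν ≤
      ∫⁻ x in {x | κ ≤ |x p|}, ‖x p‖ₑ * supPd p 1 F x ∂Measure.pi ν :=
    lintegral_mono_set fun x (hx : R ≤ |x p|) => hκ.trans (hR.trans hx)
  refine hsub.trans ?_
  have hxi : ENNReal.ofReal s⁻¹ *
      (∫⁻ x in {x | κ ≤ |x p|}, ‖x p‖ₑ * supPd p 1 F x ∂Measure.pi ν) ≤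
      xiTerm κ s p (Measure.pi ν) F := by
    unfold xiTerm
    simp only [add_assoc]
    exact le_self_add
  calc _ = ENNReal.ofReal s * (ENNReal.ofReal s⁻¹ *
        (∫⁻ x in {x | κ ≤ |x p|}, ‖x p‖ₑ * supPd p 1 F x ∂Measure.pi ν)) := by
        rw [← mul_assoc, ← ENNReal.ofReal_mul hs.le, mul_inv_cancel₀ hs.ne', ENNReal.ofReal_one,
          one_mul]
    _ ≤ _ := by gcongr

omit [DecidableEq ι] in
theorem tendsto_integral_boxCutoff_smul {μ : Measure (ι → ℝ)}
    (hF : ContDiff ℝ ((⊤ : ℕ∞) : WithTop ℕ∞) F) (hi : Integrable F μ) :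
    Tendsto (fun R => ∫ x, boxCutoff R x • F x ∂μ) atTop (𝓝 (∫ x, F x ∂μ)) := by
  refine tendsto_integral_filter_of_dominated_convergence (fun x => ‖F x‖)
    (.of_forall fun R => (contDiff_boxCutoff_smul hF R).continuous.aestronglyMeasurable)
    (.of_forall fun R => .of_forall fun x => norm_smul_le_of_mem_Icc (boxCutoff_mem_Icc R x) _)
    hi.norm (.of_forall fun x => ?_)
  refine tendsto_const_nhds.congr' ?_
  filter_upwards [eventually_ge_atTop ‖x‖, eventually_gt_atTop 0] with R hR hR0
  rw [boxCutoff_eq_one hR0 hR, one_smul]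

/-- Comparison of the initial and final expectations along an Ornstein–Uhlenbeck flow of product
measures whose marginals are centered and have constant variances `s p`. -/
theorem norm_integral_pi_ouLaw_sub_le (hF : ContDiff ℝ ((⊤ : ℕ∞) : WithTop ℕ∞) F)
    {a s : ι → ℝ} (ha : ∀ p, 0 < a p) (hs : ∀ p, 0 < s p) {κ : ℝ} (hκ : κ ≤ 1)
    (h2 : ∀ p, MemLp id 2 (ν p)) (h0 : ∀ p, ∫ r, r ∂ν p = 0) (hv : ∀ p, ∫ r, r ^ 2 ∂ν p = s p)
    {t : ℝ} (ht : 0 ≤ t) {K : ℝ} (hK0 : 0 ≤ K)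
    (hK : ∀ u ∈ Set.Icc 0 t, ∀ p,
      xiTerm κ (s p) p (Measure.pi fun p => ouLaw (a p) (s p) u (ν p)) F ≤ ENNReal.ofReal K)
    (hi0 : Integrable F (Measure.pi fun p => ouLaw (a p) (s p) 0 (ν p)))
    (hit : Integrable F (Measure.pi fun p => ouLaw (a p) (s p) t (ν p)))
    (htail : ∀ η : ℝ, 0 < η → ∃ R₀ : ℝ, ∀ R, R₀ ≤ R → ∀ u ∈ Set.Icc 0 t, ∀ p,
      ∫⁻ x in {x | R ≤ |x p|}, ‖F x‖ₑ ∂(Measure.pi fun p => ouLaw (a p) (s p) u (ν p)) ≤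
        ENNReal.ofReal η) :
    ‖∫ x, F x ∂(Measure.pi fun p => ouLaw (a p) (s p) t (ν p))
      - ∫ x, F x ∂(Measure.pi fun p => ouLaw (a p) (s p) 0 (ν p))‖ ≤
      (∑ p, a p * (2 * s p * K)) * t := by
  obtain ⟨C, hC0, hC⟩ := exists_cutoff_deriv_bound
  have hR : ∀ η : ℝ, 0 < η → ∀ᶠ R in atTop,
      ‖∫ x, boxCutoff R x • F x ∂(Measure.pi fun p => ouLaw (a p) (s p) t (ν p))
        - ∫ x, boxCutoff R x • F x ∂(Measure.pi fun p => ouLaw (a p) (s p) 0 (ν p))‖ ≤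
      (∑ p, a p * (2 * s p * K + (C * (s p + 1) * η + 2 * s p * C / R * (s p * K)))) * t := by
    intro η hη
    obtain ⟨R₀, hR₀⟩ := htail η hη
    filter_upwards [eventually_ge_atTop R₀, eventually_ge_atTop 1] with R hRR₀ hR1
    have hR0 : 0 < R := by linarith
    have hG := contDiff_boxCutoff_smul hF R
    have hGc : HasCompactSupport fun x => boxCutoff R x • F x :=
      hasCompactSupport_boxCutoff_smul hR0
    -- Right derivatives and continuity suffice for this mean value inequality, so the forward
    -- equation is needed only to the right of each time.
    have hmain := norm_image_sub_le_of_norm_deriv_right_le_segment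
      (C := ∑ p, a p * (2 * s p * K + (C * (s p + 1) * η + 2 * s p * C / R * (s p * K))))
      ((continuous_integral_pi_ouLaw (a := a) (s := s) ν hG.continuous hGc).continuousOn
        (s := Set.Icc 0 t))
      (fun u hu => hasDerivWithinAt_integral_pi_ouLaw ν ha (fun p => (hs p).le) hG hGc hu.1)
      (fun u hu => ?_) t ⟨ht, le_rfl⟩
    · simpa using hmain
    · have huI : u ∈ Set.Icc 0 t := ⟨hu.1, hu.2.le⟩
      refine (norm_sum_le _ _).trans (Finset.sum_le_sum fun p _ => ?_)
      rw [norm_smul, Real.norm_of_nonneg (ha p).le]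
      refine mul_le_mul_of_nonneg_left ?_ (ha p).le
      have hsp := hs p
      have hnn : 0 ≤ 2 * s p * K + (C * (s p + 1) * η + 2 * s p * C / R * (s p * K)) := by
        positivity
      rw [← ENNReal.ofReal_le_ofReal_iff hnn, ofReal_norm]
      refine (enorm_integral_generator_boxCutoff_le hC0 hC hF hR1 hκ hsp
        (memLp_two_ouLaw (h2 p)) (integral_id_ouLaw (h2 p) (h0 p))
        (integral_sq_ouLaw (ha p).le hsp.le hu.1 (h2 p) (h0 p) (hv p))).trans ?_
      rw [ENNReal.ofReal_add (by positivity) (by positivity),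
        ENNReal.ofReal_add (by positivity) (by positivity),
        ENNReal.ofReal_mul (p := 2 * s p) (q := K) (by positivity),
        ENNReal.ofReal_mul (p := C * (s p + 1)) (by positivity),
        ENNReal.ofReal_mul (p := 2 * s p * C / R) (by positivity), ENNReal.ofReal_mul hsp.le]
      have hk := hK u huI p
      gcongr
      exact hR₀ R hRR₀ u huI p
  -- Here `R → ∞` with `η` fixed; the coefficient `0` is the limit of `2 * s p * C / R`. The limit
  -- `η → 0` comes last.
  have hη : ∀ η : ℝ, 0 < η →
      ‖∫ x, F x ∂(Measure.pi fun p => ouLaw (a p) (s p) t (ν p))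
        - ∫ x, F x ∂(Measure.pi fun p => ouLaw (a p) (s p) 0 (ν p))‖ ≤
      (∑ p, a p * (2 * s p * K + (C * (s p + 1) * η + 0 * (s p * K)))) * t := by
    intro η hη
    refine le_of_tendsto_of_tendsto ((tendsto_integral_boxCutoff_smul hF hit).sub
      (tendsto_integral_boxCutoff_smul hF hi0)).norm (Tendsto.mul_const t ?_) (hR η hη)
    refine tendsto_finsetSum _ fun p _ => Tendsto.const_mul _ (Tendsto.const_add _
      (Tendsto.const_add _ (Tendsto.mul_const _ ?_)))
    exact tendsto_const_nhds.div_atTop tendsto_id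
  have hlim : Tendsto (fun η : ℝ =>
      (∑ p, a p * (2 * s p * K + (C * (s p + 1) * η + 0 * (s p * K)))) * t) (𝓝[>] 0)
      (𝓝 ((∑ p, a p * (2 * s p * K)) * t)) := by
    have hc : Continuous fun η : ℝ =>
        (∑ p, a p * (2 * s p * K + (C * (s p + 1) * η + 0 * (s p * K)))) * t := by fun_prop
    have := (hc.tendsto 0).mono_left (nhdsWithin_le_nhds (s := Set.Ioi 0))
    simpa using this
  exact ge_of_tendsto hlim (by filter_upwards [self_mem_nhdsWithin] with η h using hη η h)

end Coord

/-! ### Symmetric matrices in upper triangular coordinates. -/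

variable {N : ℕ}

/-- The entries of a symmetric matrix on and above the diagonal. -/
def upper (M : SymMat N) (p : UpperIdx N) : ℝ := entry M p.1.1 p.1.2

/-- The upper index of the unordered pair `{k, l}`. -/
def upperIdx (k l : Fin N) : UpperIdx N := ⟨(min k l, max k l), min_le_max⟩

/-- The right-hand side is the condition in `X` and `Theta`. Through it, those matrix operations
become a unit vector and the rescaling of a single coordinate. -/
theorem upperIdx_eq_iff (k l : Fin N) (p : UpperIdx N) :
    upperIdx k l = p ↔ (k = p.1.1 ∧ l = p.1.2) ∨ (k = p.1.2 ∧ l = p.1.1) := by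
  obtain ⟨⟨i, j⟩, hij⟩ := p
  simp only [upperIdx, Subtype.mk.injEq, Prod.mk.injEq]
  rcases le_total k l with h | h
  · rw [min_eq_left h, max_eq_right h]
    constructor
    · exact Or.inl
    · rintro (h1 | ⟨rfl, rfl⟩)
      · exact h1
      · exact ⟨le_antisymm h hij, le_antisymm hij h⟩
  · rw [min_eq_right h, max_eq_left h]
    constructor
    · exact fun h => Or.inr h.symm
    · rintro (⟨rfl, rfl⟩ | h1)
      · exact ⟨le_antisymm h hij, le_antisymm hij h⟩
      · exact h1.symm

/-- The symmetric matrix with given entries on and above the diagonal. -/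
def symLin (N : ℕ) : (UpperIdx N → ℝ) →ₗ[ℝ] SymMat N where
  toFun x := ⟨Matrix.of fun k l => x (upperIdx k l), by
    ext k l
    simp only [Matrix.transpose_apply, Matrix.of_apply]
    congr 1
    simp only [upperIdx, min_comm, max_comm]⟩
  map_add' x y := by ext; rfl
  map_smul' c x := by ext; rfl

/-- `symLin` as a continuous linear map. -/
noncomputable def symCLM (N : ℕ) : (UpperIdx N → ℝ) →L[ℝ] SymMat N :=
  LinearMap.toContinuousLinearMap (symLin N)

theorem entry_symCLM (x : UpperIdx N → ℝ) (k l : Fin N) :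
    entry (symCLM N x) k l = x (upperIdx k l) := rfl

theorem ext_entry {M M' : SymMat N} (h : ∀ k l, entry M k l = entry M' k l) : M = M' :=
  Subtype.ext (Matrix.ext h)

theorem symCLM_upper (M : SymMat N) : symCLM N (upper M) = M := by
  refine ext_entry fun k l => ?_
  rw [entry_symCLM, upper]
  rcases (upperIdx_eq_iff k l (upperIdx k l)).1 rfl with ⟨h1, h2⟩ | ⟨h1, h2⟩
  · rw [← h1, ← h2]
  · rw [← h1, ← h2]
    exact M.2.apply k l

theorem symCLM_single (p : UpperIdx N) : symCLM N (Pi.single p 1) = X p.1.1 p.1.2 := by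
  refine ext_entry fun k l => ?_
  rw [entry_symCLM, Pi.single_apply]
  simp only [upperIdx_eq_iff]
  rfl

theorem symCLM_update (p : UpperIdx N) (θ : ℝ) (x : UpperIdx N → ℝ) :
    symCLM N (Function.update x p (θ * x p)) = Theta p.1.1 p.1.2 θ (symCLM N x) := by
  refine ext_entry fun k l => ?_
  have hT : entry (Theta p.1.1 p.1.2 θ (symCLM N x)) k l =
      if (k = p.1.1 ∧ l = p.1.2) ∨ (k = p.1.2 ∧ l = p.1.1) then θ * entry (symCLM N x) k l
      else entry (symCLM N x) k l := rfl
  rw [hT, entry_symCLM, entry_symCLM]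
  by_cases h : upperIdx k l = p
  · rw [if_pos ((upperIdx_eq_iff k l p).1 h), h, Function.update_self]
  · rw [if_neg fun h' => h ((upperIdx_eq_iff k l p).2 h'), Function.update_of_ne h]

theorem pderiv_symCLM (F : SymMat N → ℂ) (p : UpperIdx N) (x : UpperIdx N → ℝ) :
    pderiv p.1.1 p.1.2 F (symCLM N x) = pd p (F ∘ symCLM N) x := by
  simp only [pderiv, pd, lineDeriv, ← symCLM_single, Function.comp_apply, map_add, map_smul]

theorem pderiv_iterate_symCLM (F : SymMat N → ℂ) (p : UpperIdx N) (k : ℕ) :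
    (pderiv p.1.1 p.1.2)^[k] F ∘ symCLM N = (pd p)^[k] (F ∘ symCLM N) := by
  induction k generalizing F with
  | zero => rfl
  | succ k ih =>
    rw [Function.iterate_succ_apply, Function.iterate_succ_apply, ih]
    congr 1
    exact funext fun x => pderiv_symCLM F p x

theorem supPderiv_symCLM (F : SymMat N → ℂ) (p : UpperIdx N) (k : ℕ) (x : UpperIdx N → ℝ) :
    supPderiv p.1.1 p.1.2 k F (symCLM N x) = supPd p k (F ∘ symCLM N) x := by
  unfold supPderiv supPd
  simp_rw [← pderiv_iterate_symCLM, Function.comp_apply, symCLM_update]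

theorem supPderiv_eq (F : SymMat N → ℂ) (p : UpperIdx N) (k : ℕ) (M : SymMat N) :
    supPderiv p.1.1 p.1.2 k F M = supPd p k (F ∘ symCLM N) (upper M) := by
  rw [← supPderiv_symCLM, symCLM_upper]


theorem xiTerm_map_upper_le_Xi {F : SymMat N → ℂ}
    (hF : ContDiff ℝ ((⊤ : ℕ∞) : WithTop ℕ∞) F) {M : Ω → SymMat N}
    (hM : ∀ i j, Measurable fun ω => entry (M ω) i j) (ε : ℝ) (s : Fin N → Fin N → ℝ)
    (p : UpperIdx N) :
    xiTerm ((N : ℝ) ^ (-ε / 10)) (s p.1.1 p.1.2) p (P.map fun ω => upper (M ω))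
      (F ∘ symCLM N) ≤ Xi P ε s F M := by
  have hF' : ContDiff ℝ ((⊤ : ℕ∞) : WithTop ℕ∞) (F ∘ symCLM N) :=
    hF.comp (symCLM N).contDiff
  have hg : Measurable fun ω => upper (M ω) := measurable_pi_lambda _ fun p => hM _ _
  have m1 := measurable_supPd hF' p 1
  have m2 := measurable_supPd hF' p 2
  have m3 := measurable_supPd hF' p 3
  set κ : ℝ := (N : ℝ) ^ (-ε / 10)
  have hbig := measurableSet_le_abs_eval κ p
  have hsm : MeasurableSet {x : UpperIdx N → ℝ | |x p| < κ} :=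
    measurableSet_lt (by fun_prop) measurable_const
  refine le_trans (le_of_eq ?_) (le_iSup₂ (f := fun i j =>
    (ENNReal.ofReal (s i j)⁻¹ * (∫⁻ ω in {ω | κ ≤ |entry (M ω) i j|},
        ‖entry (M ω) i j‖ₑ * supPderiv i j 1 F (M ω) ∂P)
    + ENNReal.ofReal (s i j)⁻¹ * (∫⁻ ω in {ω | κ ≤ |entry (M ω) i j|},
        ‖entry (M ω) i j‖ₑ ^ 2 * supPderiv i j 2 F (M ω) ∂P)
    + (∫⁻ ω in {ω | κ ≤ |entry (M ω) i j|}, supPderiv i j 2 F (M ω) ∂P)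
    + ENNReal.ofReal (s i j)⁻¹ * (∫⁻ ω in {ω | |entry (M ω) i j| < κ},
        ‖entry (M ω) i j‖ₑ ^ 3 * supPderiv i j 3 F (M ω) ∂P)
    + (∫⁻ ω in {ω | |entry (M ω) i j| < κ},
        ‖entry (M ω) i j‖ₑ * supPderiv i j 3 F (M ω) ∂P))) p.1.1 p.1.2)
  unfold xiTerm
  simp_rw [supPderiv_eq]
  rw [setLIntegral_map hbig (by fun_prop) hg, setLIntegral_map hbig (by fun_prop) hg,
    setLIntegral_map hbig (by fun_prop) hg, setLIntegral_map hsm (by fun_prop) hg,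
    setLIntegral_map hsm (by fun_prop) hg]
  rfl

theorem IsGeneralizedWigner.secondMoment_pos {ε c₁ C₁ C₂ : ℝ} {H : Ω → SymMat N}
    (hW : IsGeneralizedWigner P ε c₁ C₁ C₂ H) (i j : Fin N) : 0 < secondMoment P H i j := by
  have h1 := hW.c₁_pos.trans (hW.variance_lower i j)
  have h2 : (0 : ℝ) < N := by exact_mod_cast hW.size_pos
  exact (mul_pos_iff_of_pos_left h2).1 h1

theorem IsGeneralizedWigner.memLp_entry {ε c₁ C₁ C₂ : ℝ} {H : Ω → SymMat N}
    (hW : IsGeneralizedWigner P ε c₁ C₁ C₂ H) (i j : Fin N) :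
    MemLp (fun ω => entry (H ω) i j) 2 P := by
  rw [memLp_two_iff_integrable_sq (hW.measurable_entry i j).aestronglyMeasurable]
  -- The Bochner integral of a non-integrable function is `0`, so a positive second moment already
  -- forces square integrability.
  by_contra h
  have := hW.secondMoment_pos i j
  simp only [secondMoment, sq_abs] at this
  rw [integral_undef h] at this
  exact lt_irrefl _ this

/-- The law of an Ornstein–Uhlenbeck matrix flow started at a generalized Wigner matrix. -/
theorem IsOUFlow.map_upper [IsProbabilityMeasure P] {ε c₁ C₁ C₂ : ℝ}
    {B : Fin N → Fin N → ℝ≥0 → Ω → ℝ} {H : ℝ≥0 → Ω → SymMat N}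
    (hW : IsGeneralizedWigner P ε c₁ C₁ C₂ (H 0)) (hH : IsOUFlow P B H) (t : ℝ≥0) :
    P.map (fun ω => upper (H t ω)) = Measure.pi fun p : UpperIdx N =>
      ouLaw (2 * N * secondMoment P (H 0) p.1.1 p.1.2)⁻¹ (secondMoment P (H 0) p.1.1 p.1.2) t
        (P.map fun ω => entry (H 0 ω) p.1.1 p.1.2) := by
  have hN : (0 : ℝ) < N := by exact_mod_cast hW.size_pos
  refine map_ou_process (y := fun (p : UpperIdx N) t ω => entry (H t ω) p.1.1 p.1.2)
    (B := fun (p : UpperIdx N) => B p.1.1 p.1.2) (c := fun _ => (√(N : ℝ))⁻¹) (fun p => ?_)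
    (fun _ => by positivity) (fun p => ?_) (fun p u => hH.measurable_entry u _ _)
    (fun p u => hH.noise.measurable _ _ u)
    (fun p => (hH.noise.brownian _ _).toIsPreBrownianReal) hH.noise.indep hW.indep ?_ ?_ ?_ t
  · have := hW.secondMoment_pos p.1.1 p.1.2
    positivity
  -- The relation `1 / N = 2 a s`: the stationary variance equals the initial one.
  · have := (hW.secondMoment_pos p.1.1 p.1.2).ne'
    rw [inv_pow, Real.sq_sqrt hN.le]
    field_simp
  · exact hH.indep_initial.comp (φ := fun h (p : UpperIdx N) => h p.1.1 p.1.2)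
      (ψ := fun b (p : UpperIdx N) => b p.1.1 p.1.2) (by fun_prop) (by fun_prop)
  · filter_upwards [hH.continuous_paths] with ω hω p using hω _ _
  · filter_upwards [hH.equation] with ω hω p u using hω _ _ u

/-- Chebyshev's inequality for a coordinate. -/
theorem pi_le_abs_eval_le {ι : Type*} [Fintype ι] {ν : ι → Measure ℝ}
    [∀ p, IsProbabilityMeasure (ν p)] {p : ι} {s R : ℝ} (hR : 0 < R) (h2 : MemLp id 2 (ν p))
    (hv : ∫ r, r ^ 2 ∂ν p = s) :
    Measure.pi ν {x | R ≤ |x p|} ≤ ENNReal.ofReal (s / R ^ 2) := by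
  have hset : {x : ι → ℝ | R ≤ |x p|} = Function.eval p ⁻¹' {r | R ^ 2 ≤ r ^ 2} := by
    ext x
    simp [sq_le_sq, abs_of_pos hR]
  have hm : MeasurableSet {r : ℝ | R ^ 2 ≤ r ^ 2} := measurableSet_le (by fun_prop) (by fun_prop)
  rw [hset, (measurePreserving_eval ν p).measure_preimage hm.nullMeasurableSet]
  have := mul_meas_ge_le_integral_of_nonneg (μ := ν p) (f := fun r => r ^ 2)
    (.of_forall fun r => sq_nonneg r) h2.integrable_sq (R ^ 2)
  rw [hv] at this
  rw [← ofReal_measureReal]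
  refine ENNReal.ofReal_le_ofReal ?_
  rw [le_div_iff₀ (by positivity), mul_comm]
  exact this

end WignerFlow

/-! ### Conclusion for the matrix flow. -/

theorem lemma7p7 {Ω : Type*} [MeasurableSpace Ω] (P : Measure Ω) [IsProbabilityMeasure P]
    (N : ℕ) (ε c₁ C₁ C₂ : ℝ)
    (B : Fin N → Fin N → ℝ≥0 → Ω → ℝ) (H : ℝ≥0 → Ω → WignerFlow.SymMat N)
    (hW : WignerFlow.IsGeneralizedWigner P ε c₁ C₁ C₂ (H 0))
    (hH : WignerFlow.IsOUFlow P B H)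
    (t : ℝ≥0) (F : WignerFlow.SymMat N → ℂ) (hF : ContDiff ℝ ((⊤ : ℕ∞) : WithTop ℕ∞) F)
    (hUI : UniformIntegrable (fun (s : Set.Icc (0 : ℝ≥0) t) (ω : Ω) => F (H s ω)) 1 P) :
    ‖∫ ω, (F (H t ω) - F (H 0 ω)) ∂P‖ₑ ≤
      (t : ℝ≥0∞) * (N : ℝ≥0∞) * (⨆ s ∈ Set.Icc (0 : ℝ≥0) t,
        WignerFlow.Xi P ε (WignerFlow.secondMoment P (H 0)) F (H s)) := by
  open WignerFlow in
  -- If `Ξ = ∞`, the right-hand side is infinite only for `t ≠ 0`; at `t = 0` both sides vanish.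
  rcases eq_or_ne t 0 with rfl | ht
  · simp
  set Ξ := ⨆ s ∈ Set.Icc (0 : ℝ≥0) t, Xi P ε (secondMoment P (H 0)) F (H s)
  have hN0 : N ≠ 0 := hW.size_pos.ne'
  rcases eq_or_ne Ξ ∞ with hΞ | hΞ
  · rw [hΞ, ENNReal.mul_top (mul_ne_zero (by simpa using ht) (by simpa using hN0))]
    exact le_top
  have hN : (0 : ℝ) < N := by exact_mod_cast hW.size_pos
  set s : UpperIdx N → ℝ := fun p => secondMoment P (H 0) p.1.1 p.1.2 with hs_def
  set a : UpperIdx N → ℝ := fun p => (2 * N * s p)⁻¹ with ha_def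
  set ν : UpperIdx N → Measure ℝ := fun p => P.map fun ω => entry (H 0 ω) p.1.1 p.1.2 with hν_def
  have hs : ∀ p, 0 < s p := fun p => hW.secondMoment_pos _ _
  have ha : ∀ p, 0 < a p := fun p => by have := hs p; positivity
  have hm0 : ∀ i j, Measurable fun ω => entry (H 0 ω) i j := hW.measurable_entry
  have hν : ∀ p, IsProbabilityMeasure (ν p) := fun p =>
    Measure.isProbabilityMeasure_map (hm0 _ _).aemeasurable
  have h2 : ∀ p, MemLp id 2 (ν p) := fun p =>
    (memLp_map_measure_iff (by fun_prop) (hm0 _ _).aemeasurable).2 (hW.memLp_entry _ _)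
  have h0 : ∀ p, ∫ r, r ∂ν p = 0 := fun p => by
    rw [hν_def, integral_map (hm0 _ _).aemeasurable (by fun_prop)]
    exact hW.centered _ _
  have hv : ∀ p, ∫ r, r ^ 2 ∂ν p = s p := fun p => by
    rw [hν_def, integral_map (hm0 _ _).aemeasurable (by fun_prop)]
    simp only [hs_def, secondMoment, sq_abs]
  have hlaw : ∀ u : ℝ≥0, P.map (fun ω => upper (H u ω)) =
      Measure.pi fun p => ouLaw (a p) (s p) u (ν p) := fun u => hH.map_upper hW u
  have hup : ∀ u, Measurable fun ω => upper (H u ω) := fun u =>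
    measurable_pi_lambda _ fun p => hH.measurable_entry u _ _
  set G : (UpperIdx N → ℝ) → ℂ := F ∘ symCLM N with hG_def
  have hG : ContDiff ℝ ((⊤ : ℕ∞) : WithTop ℕ∞) G := hF.comp (symCLM N).contDiff
  have hGH : ∀ u ω, G (upper (H u ω)) = F (H u ω) := fun u ω => by
    rw [hG_def, Function.comp_apply, symCLM_upper]
  have hint : ∀ u ∈ Set.Icc (0 : ℝ≥0) t, Integrable (fun ω => F (H u ω)) P := fun u hu =>
    memLp_one_iff_integrable.1 (hUI.memLp ⟨u, hu⟩)
  have hintG : ∀ u ∈ Set.Icc (0 : ℝ≥0) t,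
      Integrable G (Measure.pi fun p => ouLaw (a p) (s p) u (ν p)) := fun u hu => by
    rw [← hlaw, integrable_map_measure hG.continuous.aestronglyMeasurable (hup u).aemeasurable]
    refine (hint u hu).congr (.of_forall fun ω => (hGH u ω).symm)
  have hexp : ∀ u : ℝ≥0, ∫ ω, F (H u ω) ∂P =
      ∫ x, G x ∂Measure.pi fun p => ouLaw (a p) (s p) u (ν p) := fun u => by
    rw [← hlaw, integral_map (hup u).aemeasurable hG.continuous.aestronglyMeasurable]
    simp_rw [hGH]
  -- A level at most `1` ensures that a box cutoff with `R ≥ 1` is constant in `x p` on the region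
  -- of small `x p`.
  have hκ : (N : ℝ) ^ (-ε / 10) ≤ 1 :=
    Real.rpow_le_one_of_one_le_of_nonpos (by exact_mod_cast hW.size_pos)
      (by have := hW.eps_pos; linarith)
  have hreal : ∀ u ∈ Set.Icc (0 : ℝ) t, ((u.toNNReal : ℝ≥0) : ℝ) = u ∧
      u.toNNReal ∈ Set.Icc (0 : ℝ≥0) t := fun u hu =>
    ⟨Real.coe_toNNReal u hu.1, zero_le, Real.toNNReal_le_iff_le_coe.2 hu.2⟩
  have hmain := norm_integral_pi_ouLaw_sub_le (ν := ν) hG ha hs hκ h2 h0 hv t.coe_nonneg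
    (K := Ξ.toReal) ENNReal.toReal_nonneg (fun u hu p => ?_)
    (by simpa using hintG 0 ⟨le_rfl, zero_le⟩) (hintG t ⟨zero_le, le_rfl⟩) fun η hη => ?_
  · have h00 : ∫ x, G x ∂(Measure.pi fun p => ouLaw (a p) (s p) 0 (ν p)) =
        ∫ ω, F (H 0 ω) ∂P := by simpa using (hexp 0).symm
    rw [h00, ← hexp t, ← integral_sub (hint t ⟨zero_le, le_rfl⟩) (hint 0 ⟨le_rfl, zero_le⟩)]
      at hmain
    rw [← ofReal_norm]
    refine (ENNReal.ofReal_le_ofReal hmain).trans ?_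
    have hsum : ∑ p, a p * (2 * s p * Ξ.toReal) ≤ N * Ξ.toReal := by
      have hterm : ∀ p, a p * (2 * s p * Ξ.toReal) = (N : ℝ)⁻¹ * Ξ.toReal := fun p => by
        have := (hs p).ne'
        rw [ha_def]
        field_simp
      simp_rw [hterm]
      rw [Finset.sum_const, nsmul_eq_mul, ← mul_assoc]
      refine mul_le_mul_of_nonneg_right ?_ ENNReal.toReal_nonneg
      -- Each coordinate contributes `Ξ / N`, so the crude count `N²` is all that is needed.
      have hcard : (Finset.univ : Finset (UpperIdx N)).card ≤ N * N := by
        rw [Finset.card_univ]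
        refine (Fintype.card_subtype_le _).trans ?_
        simp
      rw [← div_eq_mul_inv, div_le_iff₀ hN]
      exact_mod_cast hcard
    calc ENNReal.ofReal ((∑ p, a p * (2 * s p * Ξ.toReal)) * t)
        ≤ ENNReal.ofReal (N * Ξ.toReal * t) := by gcongr
      _ = t * N * Ξ := by
        rw [ENNReal.ofReal_mul (by positivity), ENNReal.ofReal_mul (by positivity),
          ENNReal.ofReal_toReal hΞ, ENNReal.ofReal_natCast, ENNReal.ofReal_coe_nnreal]
        ring
  · obtain ⟨hu1, hu2⟩ := hreal u hu
    have h := xiTerm_map_upper_le_Xi (P := P) hF (M := H u.toNNReal)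
      (hH.measurable_entry u.toNNReal) ε (secondMoment P (H 0)) p
    rw [hlaw, hu1] at h
    rw [ENNReal.ofReal_toReal hΞ]
    exact h.trans (le_iSup₂ (f := fun s (_ : s ∈ Set.Icc (0 : ℝ≥0) t) =>
      Xi P ε (secondMoment P (H 0)) F (H s)) u.toNNReal hu2)
  · obtain ⟨δ, hδ, hUIδ⟩ := hUI.unifIntegrable hη
    -- The variances do not change with time, so Chebyshev gives one threshold for all `u`. The `1`
    -- permits `s p / R ^ 2 ≤ s p / R ≤ δ`, and the sum makes the threshold independent of `p`.
    refine ⟨max 1 ((∑ p, s p) / δ), fun R hR u hu p => ?_⟩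
    obtain ⟨hu1, hu2⟩ := hreal u hu
    have hR1 : 1 ≤ R := (le_max_left _ _).trans hR
    have hR0 : 0 < R := by linarith
    have hRδ : (∑ p, s p) / δ ≤ R := (le_max_right _ _).trans hR
    have hset := measurableSet_le_abs_eval R p
    have hcheb := pi_le_abs_eval_le (ν := fun p => ouLaw (a p) (s p) u (ν p)) hR0
      (memLp_two_ouLaw (h2 p)) (integral_sq_ouLaw (ha p).le (hs p).le hu.1 (h2 p) (h0 p) (hv p))
    have hle : s p / R ^ 2 ≤ δ := by
      have h1 : s p ≤ ∑ p, s p := Finset.single_le_sum (fun q _ => (hs q).le) (Finset.mem_univ p)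
      rw [div_le_iff₀ hδ] at hRδ
      rw [div_le_iff₀ (by positivity)]
      nlinarith [mul_nonneg (mul_nonneg hδ.le hR0.le) (sub_nonneg.2 hR1)]
    have hl := hlaw u.toNNReal
    rw [hu1] at hl
    rw [← hl, Measure.map_apply (hup _) hset] at hcheb
    have hE := hUIδ ⟨u.toNNReal, hu2⟩ _ (hup _ hset)
      (hcheb.trans (ENNReal.ofReal_le_ofReal hle))
    rw [eLpNorm_indicator_eq_eLpNorm_restrict (hup _ hset), eLpNorm_one_eq_lintegral_enorm] at hE
    rw [← hl, setLIntegral_map hset hG.continuous.enorm.measurable (hup _)]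
    simp_rw [hGH]
    exact hE
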